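/- Proposition \label{TH1}. Work in $L^2(\mathbf R)$ with $\hbar=1$, position operator $(Q\psi)(x)=x\psi(x)$, momentum operator $P=-i\,d/dx$, parity operator $(\Pi\psi)(x)=\psi(-x)$, displacement operators $D(q,p)=\exp i(pQ-qP)$, that is $(D(q,p)\psi)(x)=e^{i(px-qp/2)}\psi(x-q)$, and number states $|n\rangle=(n!)^{-1/2}(a^\dagger)^n|0\rangle$, where $a^\dagger=(Q-iP)/\sqrt2$ and $|0\rangle=\pi^{-1/4}e^{-x^2/2}$. For $\theta\in\mathbf R$ let $Q_\theta=Q\cos\theta+P\sin\theta$ (the closure of this operator from the Schwartz space $\mathcal S(\mathbf R)$), and let $L>0$. Let $$K_L^\theta=\int_{-L/2}^{L/2}D(-s\sin\theta,s\cos\theta)\,\Pi\,D(-s\sin\theta,s\cos\theta)^\dagger\,ds$$ (strongly convergent integral) be the region operator of the segment of length $L$ centred at the origin of the $(q,p)$-plane that is obtained by rotating a segment of the $p$-axis by the angle $\theta$ (so the normal of the segment makes the angle $\theta$ with the $q$-axis; $\theta=0$ is a segment of the $p$-axis and $\theta=\pi/2$ a segment of the $q$-axis). Let $f_L(x)=\sin(xL)/x$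 for $x\ne0$ and $f_L(0)=L$. Then: (a) For every $q_\theta\in\mathbf R$ there is exactly one generalized ket $|q_\theta\rangle$ (a continuous conjugate-linear functional on $\mathcal S(\mathbf R)$) with $$\langle q_\theta|n\rangle=\frac1{\pi^{1/4}}\frac1{2^{n/2}(n!)^{1/2}}\exp(-q_\theta^2/2)\,H_n(q_\theta)\exp(-in\theta)\qquad(n\ge0),$$ $H_n$ being the (physicists') Hermite polynomials. The family $\{|q_\theta\rangle:q_\theta\in\mathbf R\}$ is complete, $\int|q_\theta\rangle\langle q_\theta|\,dq_\theta=\mathbf 1$ as a sesquilinear form on $\mathcal S(\mathbf R)$, and $Q_\theta|q_\theta\rangle=q_\theta|q_\theta\rangle$. (b) $Q_\theta$ is self-adjoint and $$K_L^\theta=f_L(Q_\theta)\,\Pi=\frac{\sin[(Q\cos\theta+P\sin\theta)L]}{Q\cos\theta+P\sin\theta}\,\Pi$$ in the sense of the functional calculus. (c) Put $|\Psi_\pm^\theta\rangle=|q_\theta\rangle\pm|-q_\theta\rangle$. Then $|\Psi_+^\theta\rangle\neq0$ for every $q_\theta\in\mathbf R$, $|\Psi_-^\theta\rangle\ne0$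 for every $q_\theta\neq0$, and these are generalized eigenvectors: $$K_L^\theta|\Psi_\pm^\theta\rangle=\pm\frac{\sin(q_\theta L)}{q_\theta}\,|\Psi_\pm^\theta\rangle,$$ where the quotient is read as $f_L(q_\theta)$, i.e. as $L$ at $q_\theta=0$. Here $K_L^\theta$ acts on generalized kets by duality, $\langle\varphi|K_L^\theta F\rangle=\langle (K_L^{\theta})^\dagger\varphi|F\rangle$, and $(K_L^\theta)^\dagger$ maps $\mathcal S(\mathbf R)$ into itself. -/

import Mathlib

open MeasureTheory
open scoped SchwartzMap ENNReal ComplexConjugate InnerProductSpace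

noncomputable section

namespace PhaseSpace

/-! ## Hilbert space and Schwartz space (`ℏ = 1`, Schrödinger representation) -/

/-- The Hilbert space `L²(ℝ)` of a one-dimensional quantum system. -/
abbrev Hilb : Type := Lp ℂ 2 (volume : Measure ℝ)

/-- The inclusion of the Schwartz space into `L²(ℝ)`. -/
def incl : 𝓢(ℝ, ℂ) →L[ℂ] Hilb := SchwartzMap.toLpCLM ℂ ℂ 2 volume

theorem incl_injective : Function.Injective incl :=
  SchwartzMap.injective_toLp (F := ℂ) 2 (volume : Measure ℝ)

/-- The position operator `(Q f)(x) = x f(x)` on the Schwartz space. -/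
def position : 𝓢(ℝ, ℂ) →L[ℂ] 𝓢(ℝ, ℂ) :=
  SchwartzMap.smulLeftCLM ℂ (fun x : ℝ => (x : ℂ))

/-- The momentum operator `(P f)(x) = -i f'(x)` on the Schwartz space. -/
def momentum : 𝓢(ℝ, ℂ) →L[ℂ] 𝓢(ℝ, ℂ) :=
  (-Complex.I) • SchwartzMap.derivCLM ℂ ℂ

theorem position_apply (f : 𝓢(ℝ, ℂ)) (x : ℝ) : position f x = (x : ℂ) * f x := by
  have h : (fun x : ℝ => (x : ℂ)).HasTemperateGrowth :=
    Complex.ofRealCLM.hasTemperateGrowth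
  simp [position, SchwartzMap.smulLeftCLM_apply_apply h]

theorem momentum_apply (f : 𝓢(ℝ, ℂ)) (x : ℝ) : momentum f x = -Complex.I * deriv f x := by
  simp [momentum]

/-! ## Quadratures as unbounded operators -/

/-- `Q cos θ + P sin θ` on the Schwartz space. -/
def quadratureCore (θ : ℝ) : 𝓢(ℝ, ℂ) →L[ℂ] 𝓢(ℝ, ℂ) :=
  (Real.cos θ : ℂ) • position + (Real.sin θ : ℂ) • momentum

/-- The operator in `L²(ℝ)` with domain the Schwartz space that acts there as the given map. -/
def onSchwartz (A : 𝓢(ℝ, ℂ) →L[ℂ] 𝓢(ℝ, ℂ)) : Hilb →ₗ.[ℂ] Hilb where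
  domain := LinearMap.range incl.toLinearMap
  toFun := incl.toLinearMap ∘ₗ A.toLinearMap ∘ₗ
    (LinearEquiv.ofInjective incl.toLinearMap incl_injective).symm.toLinearMap

/-- The rotated quadrature `Q_θ = Q cos θ + P sin θ` as a closed operator in `L²(ℝ)`: the closure of
its restriction to the Schwartz space. -/
def quadrature (θ : ℝ) : Hilb →ₗ.[ℂ] Hilb := (onSchwartz (quadratureCore θ)).closure

/-- Functional calculus of self-adjoint operators: `T = f(A)`. There is a unitary `U` onto some
`L²(X, μ)` that carries `A`, domain included, to multiplication by a measurable real function `h`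
(so that `A` is self-adjoint), and `U` carries `T` to multiplication by `f ∘ h`. It is used for
bounded Borel functions `f`; the operator `T` does not depend on the choice of `(X, μ, U, h)`. -/
def IsFunctionOf (A : Hilb →ₗ.[ℂ] Hilb) (f : ℝ → ℂ) (T : Hilb →L[ℂ] Hilb) : Prop :=
  ∃ (X : Type) (_ : MeasurableSpace X) (μ : Measure X) (U : Hilb ≃ₗᵢ[ℂ] Lp ℂ 2 μ) (h : X → ℝ),
    Measurable h ∧
    (∀ ψ : Hilb, ψ ∈ A.domain ↔ MemLp (fun x => (h x : ℂ) * U ψ x) 2 μ) ∧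
    (∀ ψ : A.domain, ∀ᵐ x ∂μ, U (A ψ) x = (h x : ℂ) * U (ψ : Hilb) x) ∧
    (∀ ψ : Hilb, ∀ᵐ x ∂μ, U (T ψ) x = f (h x) * U ψ x)

/-- The continuous function `x ↦ sin (x L) / x` on `ℝ`, with value `L` at `x = 0`. -/
def sinOver (L x : ℝ) : ℝ := if x = 0 then L else Real.sin (x * L) / x

/-! ## Parity, displacement operators, region operators -/

/-- The parity operator `(Π ψ)(x) = ψ(-x)`. -/
def parity : Hilb →L[ℂ] Hilb :=
  (Lp.compMeasurePreservingₗᵢ ℂ (fun x : ℝ => -x)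
    (Measure.measurePreserving_neg (volume : Measure ℝ))).toContinuousLinearMap

/-- The translation `(T_q ψ)(x) = ψ(x - q)`, that is `exp (-i q P)`. -/
def translation (q : ℝ) : Hilb →L[ℂ] Hilb :=
  (Lp.compMeasurePreservingₗᵢ ℂ (fun x : ℝ => x - q)
    (measurePreserving_sub_right (volume : Measure ℝ) q)).toContinuousLinearMap

/-- The phase `x ↦ exp (i (p x - q p / 2))`. -/
def weylPhase (q p x : ℝ) : ℂ := Complex.exp (Complex.I * ((p * x - q * p / 2 : ℝ) : ℂ))

theorem memLp_weylPhase (q p : ℝ) : MemLp (weylPhase q p) ∞ (volume : Measure ℝ) := by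
  refine memLp_top_of_bound (C := 1) ?_ (Filter.Eventually.of_forall fun x => ?_)
  · refine Continuous.aestronglyMeasurable ?_
    unfold weylPhase
    fun_prop
  · rw [weylPhase, mul_comm, Complex.norm_exp_ofReal_mul_I]

/-- The displacement operator `D(q, p) = exp (i (p Q - q P))`, in the Schrödinger representation:
`(D(q, p) ψ)(x) = exp (i (p x - q p / 2)) ψ(x - q)`. -/
def displacement (q p : ℝ) : Hilb →L[ℂ] Hilb :=
  ((ContinuousLinearMap.mul ℂ ℂ).holderL (volume : Measure ℝ) ∞ 2 2
    (memLp_weylPhase q p).toLp) ∘L translation q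

theorem displacement_apply (q p : ℝ) (ψ : Hilb) :
    ∀ᵐ x : ℝ, displacement q p ψ x = weylPhase q p x * ψ (x - q) := by
  have h1 := (ContinuousLinearMap.mul ℂ ℂ).coeFn_holder (r := 2)
    (memLp_weylPhase q p).toLp (translation q ψ)
  have h2 : translation q ψ =ᵐ[volume] ψ ∘ fun x : ℝ => x - q :=
    Lp.coeFn_compMeasurePreserving ψ (measurePreserving_sub_right (volume : Measure ℝ) q)
  have h3 := (memLp_weylPhase q p).coeFn_toLp
  filter_upwards [h1, h2, h3] with x e1 e2 e3
  refine Eq.trans e1 ?_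
  simp [e2, e3]

/-- The displaced parity operator `D(q, p) Π D(q, p)†`, the region operator of the point `(q, p)`. -/
def pointOperator (q p : ℝ) : Hilb →L[ℂ] Hilb :=
  displacement q p ∘L parity ∘L ContinuousLinearMap.adjoint (displacement q p)

/-- `K` is the region operator of the segment of length `L` that is centred at the origin of the
phase plane and has the unit direction vector `d = (d.1, d.2)` (first component along the `q`-axis,
second along the `p`-axis):
`K = ∫_{-L/2}^{L/2} D(s d) Π D(s d)† ds`, a strongly convergent operator integral. -/
def IsSegmentOperator (d : ℝ × ℝ) (L : ℝ) (K : Hilb →L[ℂ] Hilb) : Prop :=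
  ∀ ψ : Hilb,
    IntervalIntegrable (fun s : ℝ => pointOperator (s * d.1) (s * d.2) ψ) volume (-L / 2) (L / 2) ∧
    K ψ = ∫ s in (-L / 2)..(L / 2), pointOperator (s * d.1) (s * d.2) ψ

/-! ## Number states -/

theorem iteratedDeriv_gaussian (n : ℕ) (x : ℝ) :
    iteratedDeriv n (fun y : ℝ => Real.exp (-(y ^ 2 / 2))) x =
      (-1 : ℝ) ^ n * Polynomial.aeval x (Polynomial.hermite n) * Real.exp (-(x ^ 2 / 2)) := by
  rw [iteratedDeriv_eq_iterate]
  exact Polynomial.deriv_gaussian_eq_hermite_mul_gaussian n x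

theorem poly_gaussian_bounded (p : Polynomial ℝ) :
    ∃ C : ℝ, ∀ x : ℝ, |p.eval x| * Real.exp (-(x ^ 2 / 2)) ≤ C := by
  have mono : ∀ k : ℕ, ∃ C : ℝ, ∀ x : ℝ, |x| ^ k * Real.exp (-(x ^ 2 / 2)) ≤ C := by
    intro k
    have ht := tendsto_rpow_abs_mul_exp_neg_mul_sq_cocompact (a := 1 / 2) (by norm_num) (k : ℝ)
    have hc : Continuous fun x : ℝ => |x| ^ k * Real.exp (-(x ^ 2 / 2)) := by fun_prop
    have ht' : Filter.Tendsto (fun x : ℝ => |x| ^ k * Real.exp (-(x ^ 2 / 2)))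
        (Filter.cocompact ℝ) (nhds 0) := by
      refine ht.congr fun x => ?_
      rw [Real.rpow_natCast]
      congr 2
      ring
    let g : ZeroAtInftyContinuousMap ℝ ℝ := ⟨⟨_, hc⟩, ht'⟩
    obtain ⟨C, hC⟩ := (ZeroAtInftyContinuousMap.isBounded_range g).exists_norm_le
    exact ⟨C, fun x => (le_abs_self _).trans (hC _ ⟨x, rfl⟩)⟩
  choose C hC using mono
  refine ⟨∑ k ∈ Finset.range (p.natDegree + 1), |p.coeff k| * C k, fun x => ?_⟩
  rw [Polynomial.eval_eq_sum_range]
  refine (mul_le_mul_of_nonneg_right (Finset.abs_sum_le_sum_abs _ _)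
    (Real.exp_pos _).le).trans ?_
  rw [Finset.sum_mul]
  refine Finset.sum_le_sum fun k _ => ?_
  rw [abs_mul, abs_pow, mul_assoc]
  exact mul_le_mul_of_nonneg_left (hC k x) (abs_nonneg _)

/-- The Gaussian `x ↦ exp (-x² / 2)` as a real Schwartz function. -/
def gaussian : 𝓢(ℝ, ℝ) where
  toFun x := Real.exp (-(x ^ 2 / 2))
  smooth' := by fun_prop
  decay' := by
    intro k n
    obtain ⟨C, hC⟩ := poly_gaussian_bounded
      (Polynomial.X ^ k * (Polynomial.hermite n).map (Int.castRingHom ℝ))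
    refine ⟨C, fun x => ?_⟩
    rw [norm_iteratedFDeriv_eq_norm_iteratedDeriv, iteratedDeriv_gaussian]
    refine le_of_eq_of_le ?_ (hC x)
    simp [abs_mul, Polynomial.aeval_def, Polynomial.eval_map, mul_assoc]

/-- The number state `|0⟩`, the function `x ↦ π^(-1/4) exp (-x² / 2)`. -/
def vacuum : 𝓢(ℝ, ℂ) :=
  ((Real.pi ^ (-(1 / 4) : ℝ) : ℝ) : ℂ) • SchwartzMap.postcompCLM (𝕜 := ℝ) Complex.ofRealCLM gaussian

theorem vacuum_apply (x : ℝ) :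
    vacuum x = ((Real.pi ^ (-(1 / 4) : ℝ) * Real.exp (-(x ^ 2 / 2)) : ℝ) : ℂ) := by
  rw [Complex.ofReal_mul]
  rfl

/-- The creation operator `a† = (Q - i P) / √2` on the Schwartz space. -/
def creation : 𝓢(ℝ, ℂ) →L[ℂ] 𝓢(ℝ, ℂ) :=
  (((√2)⁻¹ : ℝ) : ℂ) • (position - Complex.I • momentum)

/-- The number state `|n⟩ = (n!)^(-1/2) (a†)^n |0⟩`. -/
def numberState (n : ℕ) : 𝓢(ℝ, ℂ) :=
  (((√(n.factorial : ℝ))⁻¹ : ℝ) : ℂ) • (creation^[n] vacuum)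

/-- The (physicists') Hermite polynomials: `H₀ = 1`, `Hₙ₊₁ = 2 X Hₙ - Hₙ'`. -/
def hermiteH : ℕ → Polynomial ℝ
  | 0 => 1
  | n + 1 => 2 * Polynomial.X * hermiteH n - Polynomial.derivative (hermiteH n)

/-! ## Generalized vectors -/

/-- Generalized kets: continuous conjugate-linear functionals `φ ↦ ⟨φ|F⟩` on the Schwartz space. A
vector `ψ` of `L²(ℝ)` is identified with `φ ↦ ⟪φ, ψ⟫`. -/
abbrev Ket : Type := 𝓢(ℝ, ℂ) →L⋆[ℂ] ℂ

/-- `K |F⟩ = |G⟩` for a bounded operator `K` and generalized kets `F`, `G`: the adjoint `K†` maps the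
Schwartz space into itself, and `⟨φ|G⟩ = ⟨K† φ|F⟩` for all Schwartz functions `φ`. -/
def MapsKet (K : Hilb →L[ℂ] Hilb) (F G : Ket) : Prop :=
  ∀ φ : 𝓢(ℝ, ℂ), ∃ η : 𝓢(ℝ, ℂ), incl η = ContinuousLinearMap.adjoint K (incl φ) ∧ G φ = F η

/-- `F` is a generalized eigenvector of `K` with eigenvalue `c`. -/
def IsGeneralizedEigenvector (K : Hilb →L[ℂ] Hilb) (c : ℂ) (F : Ket) : Prop :=
  F ≠ 0 ∧ MapsKet K F (c • F)

/-- The family `|q⟩`, `q ∈ ℝ`, is complete: `∫ |q⟩⟨q| dq = 1`, as a sesquilinear form on the Schwartz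
space (the integrand is `⟨φ|q⟩⟨q|χ⟩`). -/
def IsCompleteFamily (ket : ℝ → Ket) : Prop :=
  ∀ φ χ : 𝓢(ℝ, ℂ), Integrable (fun q : ℝ => ket q φ * conj (ket q χ)) ∧
    ∫ q : ℝ, ket q φ * conj (ket q χ) = ⟪incl φ, incl χ⟫_ℂ

/-- The Hermite-function coefficient
`π^(-1/4) 2^(-n/2) (n!)^(-1/2) exp (-q² / 2) H_n(q) exp (-i n θ)`. -/
def hermiteCoeff (θ q : ℝ) (n : ℕ) : ℂ :=
  ((1 / Real.pi ^ (1 / 4 : ℝ) * (1 / ((2 : ℝ) ^ ((n : ℝ) / 2) * (n.factorial : ℝ) ^ (1 / 2 : ℝ))) *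
      Real.exp (-q ^ 2 / 2) * (hermiteH n).eval q : ℝ) : ℂ) *
    Complex.exp (-(Complex.I * (n : ℂ) * (θ : ℂ)))

end PhaseSpace

end

noncomputable section

namespace PhaseSpace

open FourierTransform

/-! ## Smooth multipliers of the Schwartz space -/

/-! The theorem is the case `θ = 0` transported by the metaplectic operator of a rotation. An
automorphism `V` of the Schwartz space, isometric in `L²`, is built that carries displacements and
their generators along the rotation by `-θ` and commutes with parity (`exists_implements_rotation`):
a rotation is a product of three shears, and shears are implemented by multiplication with chirps
and by their Fourier conjugates. Once its phase is fixed by `V vacuum = vacuum`, covariance of the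
creation operator gives `V |n⟩ = exp (-i n θ) |n⟩`.

The kets are `⟨φ|q_θ⟩ = conj ((V φ) q)`. Their coefficients are then Hermite functions times a
phase, completeness is the isometry of `V`, and `V` turns `Q_θ` into multiplication by `x`.
Uniqueness requires the number states to be total in the Schwartz topology (`ket_eq_zero`): every
ket is bounded by an `L²` norm after a power of `Q² + P² + 1`, this operator maps the span of the
number states onto itself, and the span is dense in `L²`.

For the region operator, `V` sends the rotated segment to a segment of the `p`-axis, where `D Π D†`
is multiplication by `exp (2 i s x)` after parity. Integrating over `s` gives multiplication by `sin
(x L) / x`. That the closure of `Q_θ` is the full multiplication operator by `x`, domain included,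
is `mem_closure_graph_iff`. The eigenvalue equations hold because this multiplier is even and
preserves the Schwartz space. -/

theorem hasTemperateGrowth_of_iteratedDeriv_bounded {f : ℝ → ℂ} (hf : ContDiff ℝ (⊤ : ℕ∞) f)
    (hb : ∀ n : ℕ, ∃ C : ℝ, ∀ x, ‖iteratedDeriv n f x‖ ≤ C) : f.HasTemperateGrowth := by
  refine ⟨hf, fun n => ?_⟩
  obtain ⟨C, hC⟩ := hb n
  exact ⟨0, C, fun x => by simpa [norm_iteratedFDeriv_eq_norm_iteratedDeriv] using hC x⟩

theorem iteratedDeriv_exp_I_mul (n : ℕ) :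
    iteratedDeriv n (fun t : ℝ => Complex.exp (Complex.I * (t : ℂ))) =
      fun t : ℝ => Complex.I ^ n * Complex.exp (Complex.I * (t : ℂ)) := by
  induction n with
  | zero => simp
  | succ n ih =>
    ext t
    rw [iteratedDeriv_succ, ih]
    have h : HasDerivAt (fun t : ℝ => Complex.exp (Complex.I * (t : ℂ)))
        (Complex.exp (Complex.I * (t : ℂ)) * (Complex.I * 1)) t :=
      ((Complex.ofRealCLM.hasDerivAt (x := t)).const_mul Complex.I).cexp
    rw [(h.const_mul (Complex.I ^ n)).deriv]
    ring

@[fun_prop]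
theorem hasTemperateGrowth_exp_I_mul :
    (fun t : ℝ => Complex.exp (Complex.I * (t : ℂ))).HasTemperateGrowth := by
  refine hasTemperateGrowth_of_iteratedDeriv_bounded ?_ fun n => ⟨1, fun x => ?_⟩
  · have : ContDiff ℝ (⊤ : ℕ∞) (fun t : ℝ => (t : ℂ)) := Complex.ofRealCLM.contDiff
    fun_prop
  · rw [iteratedDeriv_exp_I_mul]
    simp [mul_comm Complex.I, Complex.norm_exp_ofReal_mul_I]

theorem hasTemperateGrowth_weylPhase (q p : ℝ) : (weylPhase q p).HasTemperateGrowth := by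
  have h : (fun x : ℝ => p * x - q * p / 2).HasTemperateGrowth := by fun_prop
  exact hasTemperateGrowth_exp_I_mul.comp h

/-- The phase `x ↦ exp (i c x² / 2)`. -/
def chirp (c x : ℝ) : ℂ := Complex.exp (Complex.I * ((c * x ^ 2 / 2 : ℝ) : ℂ))

theorem hasTemperateGrowth_chirp (c : ℝ) : (chirp c).HasTemperateGrowth := by
  have h : (fun x : ℝ => (c / 2) * x ^ 2).HasTemperateGrowth := by fun_prop
  convert hasTemperateGrowth_exp_I_mul.comp h using 1
  ext x
  simp only [chirp, Function.comp_apply]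
  congr 3
  ring

theorem hasDerivAt_chirp (c x : ℝ) :
    HasDerivAt (chirp c) (chirp c x * (Complex.I * ((c * x : ℝ) : ℂ))) x := by
  have h1 : HasDerivAt (fun x : ℝ => c * x ^ 2 / 2) (c * x) x := by
    have := ((hasDerivAt_pow 2 x).const_mul c).div_const 2
    refine this.congr_deriv ?_
    norm_num
    ring
  exact (h1.ofReal_comp.const_mul Complex.I).cexp

theorem norm_chirp (c x : ℝ) : ‖chirp c x‖ = 1 := by
  rw [chirp, mul_comm, Complex.norm_exp_ofReal_mul_I]

theorem chirp_mul_chirp_neg (c x : ℝ) : chirp c x * chirp (-c) x = 1 := by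
  rw [chirp, chirp, ← Complex.exp_add, ← mul_add, ← Complex.ofReal_add]
  simp [neg_mul, neg_div]

/-! ## Phase-plane operators on the Schwartz space -/

/-- The displacement operator on the Schwartz space. -/
def schwartzDisplacement (z : ℝ × ℝ) : 𝓢(ℝ, ℂ) →L[ℂ] 𝓢(ℝ, ℂ) :=
  SchwartzMap.smulLeftCLM ℂ (weylPhase z.1 z.2) ∘L SchwartzMap.compSubConstCLM ℂ z.1

theorem schwartzDisplacement_apply (z : ℝ × ℝ) (f : 𝓢(ℝ, ℂ)) (x : ℝ) :
    schwartzDisplacement z f x = weylPhase z.1 z.2 x * f (x - z.1) := by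
  simp [schwartzDisplacement,
    SchwartzMap.smulLeftCLM_apply_apply (hasTemperateGrowth_weylPhase z.1 z.2)]

/-- The parity operator on the Schwartz space. -/
def schwartzParity : 𝓢(ℝ, ℂ) →L[ℂ] 𝓢(ℝ, ℂ) :=
  SchwartzMap.compCLMOfContinuousLinearEquiv ℂ (ContinuousLinearEquiv.neg ℝ)

theorem schwartzParity_apply (f : 𝓢(ℝ, ℂ)) (x : ℝ) : schwartzParity f x = f (-x) := by
  simp [schwartzParity]

/-- The generator `p Q - q P` of the displacement operators. -/
def generator (z : ℝ × ℝ) : 𝓢(ℝ, ℂ) →L[ℂ] 𝓢(ℝ, ℂ) :=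
  (z.2 : ℂ) • position - (z.1 : ℂ) • momentum

theorem generator_apply (z : ℝ × ℝ) (f : 𝓢(ℝ, ℂ)) :
    generator z f = (z.2 : ℂ) • position f - (z.1 : ℂ) • momentum f := rfl

theorem norm_incl_eq (f : 𝓢(ℝ, ℂ)) : ‖incl f‖ = ENNReal.toReal (eLpNorm f 2 volume) :=
  SchwartzMap.norm_toLp

theorem coeFn_incl (f : 𝓢(ℝ, ℂ)) : incl f =ᵐ[volume] f := SchwartzMap.coeFn_toLp f 2 volume

theorem denseRange_incl : DenseRange incl :=
  SchwartzMap.denseRange_toLpCLM ENNReal.ofNat_ne_top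

theorem inner_incl (f g : 𝓢(ℝ, ℂ)) : ⟪incl f, incl g⟫_ℂ = ∫ x, conj (f x) * g x := by
  have := SchwartzMap.inner_toL2_toL2_eq f g
  refine Eq.trans this ?_
  simp [mul_comm]

/-! ## Operators that implement transformations of the phase plane -/

/-- The automorphism `V` of the Schwartz space is isometric for the `L²` norm, commutes with parity,
and carries displacements and their generators along the transformation `A` of the phase plane. -/
structure Implements (V : 𝓢(ℝ, ℂ) ≃L[ℂ] 𝓢(ℝ, ℂ)) (A : ℝ × ℝ → ℝ × ℝ) : Prop where
  norm_map : ∀ f, ‖incl (V f)‖ = ‖incl f‖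
  map_parity : ∀ f, V (schwartzParity f) = schwartzParity (V f)
  map_displacement : ∀ z f, V (schwartzDisplacement z f) = schwartzDisplacement (A z) (V f)
  map_generator : ∀ z f, V (generator z f) = generator (A z) (V f)

theorem Implements.congr {V : 𝓢(ℝ, ℂ) ≃L[ℂ] 𝓢(ℝ, ℂ)} {A B : ℝ × ℝ → ℝ × ℝ}
    (hV : Implements V A) (h : A = B) : Implements V B := h ▸ hV

theorem Implements.trans {V W : 𝓢(ℝ, ℂ) ≃L[ℂ] 𝓢(ℝ, ℂ)} {A B : ℝ × ℝ → ℝ × ℝ}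
    (hV : Implements V A) (hW : Implements W B) : Implements (V.trans W) (B ∘ A) where
  norm_map f := by simp [hV.norm_map, hW.norm_map]
  map_parity f := by simp [hV.map_parity, hW.map_parity]
  map_displacement z f := by simp [hV.map_displacement, hW.map_displacement]
  map_generator z f := by simp [hV.map_generator, hW.map_generator]

theorem Implements.symm {V : 𝓢(ℝ, ℂ) ≃L[ℂ] 𝓢(ℝ, ℂ)} {A B : ℝ × ℝ → ℝ × ℝ}
    (hV : Implements V A) (hAB : ∀ z, A (B z) = z) : Implements V.symm B where
  norm_map f := by rw [← hV.norm_map, V.apply_symm_apply]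
  map_parity f := by
    rw [ContinuousLinearEquiv.symm_apply_eq, hV.map_parity, V.apply_symm_apply]
  map_displacement z f := by
    rw [ContinuousLinearEquiv.symm_apply_eq, hV.map_displacement, V.apply_symm_apply, hAB]
  map_generator z f := by
    rw [ContinuousLinearEquiv.symm_apply_eq, hV.map_generator, V.apply_symm_apply, hAB]

/-- A unimodular factor cancels from every clause, so an implementing operator has a free phase; it
is spent later on fixing the vacuum. -/
theorem Implements.smul {V : 𝓢(ℝ, ℂ) ≃L[ℂ] 𝓢(ℝ, ℂ)} {A : ℝ × ℝ → ℝ × ℝ}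
    (hV : Implements V A) (c : Circle) :
    ∃ W : 𝓢(ℝ, ℂ) ≃L[ℂ] 𝓢(ℝ, ℂ), Implements W A ∧ ∀ f, W f = (c : ℂ) • V f := by
  refine ⟨V.trans (ContinuousLinearEquiv.smulLeft (Circle.toUnits c)), ?_, fun f => rfl⟩
  have key : ∀ f, (V.trans (ContinuousLinearEquiv.smulLeft (Circle.toUnits c))) f
      = (c : ℂ) • V f := fun f => rfl
  constructor
  · intro f
    rw [key, map_smul, norm_smul, hV.norm_map, Circle.norm_coe, one_mul]
  · intro f
    rw [key, key, map_smul, hV.map_parity]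
  · intro z f
    rw [key, key, map_smul, hV.map_displacement]
  · intro z f
    rw [key, key, map_smul, hV.map_generator]

/-- Multiplication by a chirp. -/
def chirpEquiv (c : ℝ) : 𝓢(ℝ, ℂ) ≃L[ℂ] 𝓢(ℝ, ℂ) :=
  ContinuousLinearEquiv.equivOfInverse (SchwartzMap.smulLeftCLM ℂ (chirp c))
    (SchwartzMap.smulLeftCLM ℂ (chirp (-c)))
    (fun f => by
      ext x
      rw [SchwartzMap.smulLeftCLM_apply_apply (hasTemperateGrowth_chirp _),
        SchwartzMap.smulLeftCLM_apply_apply (hasTemperateGrowth_chirp _), smul_smul, mul_comm,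
        chirp_mul_chirp_neg, one_smul])
    (fun f => by
      ext x
      rw [SchwartzMap.smulLeftCLM_apply_apply (hasTemperateGrowth_chirp _),
        SchwartzMap.smulLeftCLM_apply_apply (hasTemperateGrowth_chirp _), smul_smul,
        chirp_mul_chirp_neg, one_smul])

theorem chirpEquiv_apply (c : ℝ) (f : 𝓢(ℝ, ℂ)) (x : ℝ) :
    chirpEquiv c f x = chirp c x * f x :=
  SchwartzMap.smulLeftCLM_apply_apply (hasTemperateGrowth_chirp _) f x

/-- The difference `c x² / 2 - c (x - q)² / 2 = c q x - c q² / 2` is affine in `x`, and its constant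
term is the one the symmetric phase acquires when `p` becomes `p + c q`. -/
theorem chirp_mul_weylPhase (c q p x : ℝ) :
    chirp c x * weylPhase q p x = weylPhase q (p + c * q) x * chirp c (x - q) := by
  simp only [chirp, weylPhase, ← Complex.exp_add, ← mul_add, ← Complex.ofReal_add]
  congr 3
  ring

theorem implements_chirpEquiv (c : ℝ) :
    Implements (chirpEquiv c) (fun z => (z.1, z.2 + c * z.1)) where
  norm_map f := by
    rw [norm_incl_eq, norm_incl_eq]
    congr 1
    refine eLpNorm_congr_norm_ae (Filter.Eventually.of_forall fun x => ?_)
    rw [chirpEquiv_apply, norm_mul, norm_chirp, one_mul]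
  map_parity f := by
    ext x
    simp [chirpEquiv_apply, schwartzParity_apply, chirp]
  map_displacement z f := by
    ext x
    simp only [chirpEquiv_apply, schwartzDisplacement_apply]
    rw [← mul_assoc, ← mul_assoc, chirp_mul_weylPhase]
  map_generator z f := by
    ext x
    have hd : deriv (chirpEquiv c f) x =
        chirp c x * (Complex.I * ((c * x : ℝ) : ℂ)) * f x + chirp c x * deriv f x := by
      have h1 : ⇑(chirpEquiv c f) = fun x => chirp c x * f x := funext (chirpEquiv_apply c f)
      rw [h1]
      exact ((hasDerivAt_chirp c x).mul f.differentiableAt.hasDerivAt).deriv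
    rw [chirpEquiv_apply, generator_apply, generator_apply]
    simp only [sub_apply, smul_apply, position_apply, momentum_apply, smul_eq_mul,
      chirpEquiv_apply, hd]
    push_cast
    linear_combination (-(z.1 : ℂ) * c * x * chirp c x * f x) * Complex.I_sq

/-- With the kernel `exp (-2 π i x ξ)` the Fourier transform implements a quarter turn combined with
a rescaling by `2 π`. The integral is shifted by `z.1` and the phases are compared. -/
theorem fourier_displacement (z : ℝ × ℝ) (f : 𝓢(ℝ, ℂ)) :
    𝓕 (schwartzDisplacement z f) =
      schwartzDisplacement (z.2 / (2 * Real.pi), -(2 * Real.pi * z.1)) (𝓕 f) := by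
  ext ξ
  rw [schwartzDisplacement_apply, SchwartzMap.fourier_coe, SchwartzMap.fourier_coe,
    Real.fourier_real_eq_integral_exp_smul, Real.fourier_real_eq_integral_exp_smul,
    ← integral_add_right_eq_self _ z.1, ← integral_const_mul]
  congr 1
  ext y
  rw [schwartzDisplacement_apply, weylPhase, weylPhase]
  simp only [smul_eq_mul, add_sub_cancel_right, ← mul_assoc, ← Complex.exp_add]
  congr 2
  have : (Real.pi : ℂ) ≠ 0 := by exact_mod_cast Real.pi_ne_zero
  push_cast
  field_simp
  ring

theorem fourier_position (f : 𝓢(ℝ, ℂ)) :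
    𝓕 (position f) = (-(1 / (2 * Real.pi) : ℝ) : ℂ) • momentum (𝓕 f) := by
  have h := SchwartzMap.lineDerivOp_fourier_eq f (1 : ℝ)
  have h2 : SchwartzMap.smulLeftCLM ℂ (inner ℝ · (1 : ℝ)) f = position f := by
    ext x
    rw [SchwartzMap.smulLeftCLM_apply_apply (by fun_prop), position_apply]
    simp
  rw [h2, FourierTransform.fourier_smul] at h
  have h3 : momentum (𝓕 f) = (-Complex.I) • LineDeriv.lineDerivOp (1 : ℝ) (𝓕 f) := by
    ext x
    rw [momentum_apply, smul_apply, SchwartzMap.lineDerivOp_apply_eq_fderiv]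
    simp
  rw [h3, h, smul_smul, smul_smul]
  have : (Real.pi : ℂ) ≠ 0 := by exact_mod_cast Real.pi_ne_zero
  rw [show ((-(1 / (2 * Real.pi) : ℝ) : ℂ) * -Complex.I * -(2 * Real.pi * Complex.I)) = 1 by
    push_cast
    field_simp
    simp, one_smul]

theorem fourier_momentum (f : 𝓢(ℝ, ℂ)) :
    𝓕 (momentum f) = ((2 * Real.pi : ℝ) : ℂ) • position (𝓕 f) := by
  have h := SchwartzMap.fourier_lineDerivOp_eq f (1 : ℝ)
  have h2 : SchwartzMap.smulLeftCLM ℂ (inner ℝ · (1 : ℝ)) (𝓕 f) = position (𝓕 f) := by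
    ext x
    rw [SchwartzMap.smulLeftCLM_apply_apply (by fun_prop), position_apply]
    simp
  have h3 : momentum f = (-Complex.I) • LineDeriv.lineDerivOp (1 : ℝ) f := by
    ext x
    rw [momentum_apply, smul_apply, SchwartzMap.lineDerivOp_apply_eq_fderiv]
    simp
  rw [h3, FourierTransform.fourier_smul, h, h2, smul_smul]
  congr 1
  push_cast
  linear_combination (-2 * Real.pi : ℂ) * Complex.I_sq

theorem implements_fourier :
    Implements (fourierCLE ℂ 𝓢(ℝ, ℂ))
      (fun z => (z.2 / (2 * Real.pi), -(2 * Real.pi * z.1))) where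
  norm_map f := SchwartzMap.norm_fourier_toL2_eq f
  map_parity f := by
    ext ξ
    simp only [fourierCLE_apply]
    rw [schwartzParity_apply, SchwartzMap.fourier_coe, SchwartzMap.fourier_coe,
      Real.fourier_real_eq_integral_exp_smul, Real.fourier_real_eq_integral_exp_smul,
      ← integral_neg_eq_self]
    congr 1
    ext y
    rw [schwartzParity_apply]
    simp
  map_displacement z f := fourier_displacement z f
  map_generator z f := by
    simp only [fourierCLE_apply]
    rw [generator_apply, generator_apply, sub_eq_add_neg, ← neg_smul, FourierTransform.fourier_add,
      FourierTransform.fourier_smul, FourierTransform.fourier_smul, fourier_position,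
      fourier_momentum, smul_smul, smul_smul]
    ext x
    simp
    ring

/-- The rotation of the phase plane by the angle `-θ`. -/
def rotation (θ : ℝ) (z : ℝ × ℝ) : ℝ × ℝ :=
  (z.1 * Real.cos θ + z.2 * Real.sin θ, -z.1 * Real.sin θ + z.2 * Real.cos θ)

/-- A Fourier-conjugated chirp of parameter `c` shears `q` by `-c / (4 π²)` times `p`, whence the
parameter `-(4 π² b)`. -/
theorem exists_implements_momentum_shear (b : ℝ) :
    ∃ V, Implements V (fun z => (z.1 + b * z.2, z.2)) := by
  have hpi : Real.pi ≠ 0 := Real.pi_ne_zero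
  have hs := implements_fourier.symm (B := fun z => (-(z.2 / (2 * Real.pi)), 2 * Real.pi * z.1))
    (fun z => Prod.ext (by simp) (by simp; field_simp))
  have h := (implements_fourier.trans (implements_chirpEquiv (-(4 * Real.pi ^ 2 * b)))).trans hs
  refine ⟨_, h.congr (funext fun z => ?_)⟩
  simp only [Function.comp_apply, Prod.mk.injEq]
  constructor
  · field_simp
    ring
  · field_simp

/-- Three shears, with parameters `-tan (t/2)`, `sin t`, `-tan (t/2)`, compose to the rotation
whenever `cos (t/2) ≠ 0`. -/
theorem exists_implements_rotation (θ : ℝ) : ∃ V, Implements V (rotation θ) := by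
  have hs : ∀ t : ℝ, Real.sin t = 2 * Real.sin (t / 2) * Real.cos (t / 2) := fun t => by
    rw [← Real.sin_two_mul, mul_div_cancel₀ t two_ne_zero]
  have hc : ∀ t : ℝ, Real.cos t = Real.cos (t / 2) ^ 2 - Real.sin (t / 2) ^ 2 := fun t => by
    rw [← Real.cos_two_mul', mul_div_cancel₀ t two_ne_zero]
  have base : ∀ t : ℝ, Real.cos (t / 2) ≠ 0 → ∃ V, Implements V (rotation t) := by
    intro t ht
    obtain ⟨W, hW⟩ := exists_implements_momentum_shear (Real.sin t)
    have h := implements_chirpEquiv (-Real.tan (t / 2))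
    refine ⟨_, ((h.trans hW).trans h).congr (funext fun z => ?_)⟩
    have h1 := Real.sin_sq_add_cos_sq (t / 2)
    have h2 : Real.tan (t / 2) * Real.cos (t / 2) = Real.sin (t / 2) := Real.tan_mul_cos ht
    have h3 : Real.tan (t / 2) * Real.sin t = 2 * Real.sin (t / 2) ^ 2 := by
      rw [hs]; linear_combination 2 * Real.sin (t / 2) * h2
    have h4 : Real.tan (t / 2) * (1 + Real.cos t) = Real.sin t := by
      rw [hc t, hs t]; linear_combination 2 * Real.cos (t / 2) * h2 - Real.tan (t / 2) * h1
    have h5 : Real.cos t = 1 - 2 * Real.sin (t / 2) ^ 2 := by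
      rw [hc]; linear_combination h1
    simp only [rotation, Function.comp_apply, Prod.mk.injEq]
    constructor
    · linear_combination (-z.1) * h3 - z.1 * h5
    · linear_combination (-z.2) * h3 - z.2 * h5 + z.1 * Real.tan (t / 2) * h3 +
        z.1 * Real.tan (t / 2) * h5 - z.1 * h4
  -- In the exceptional case the rotation by `θ/2` is used twice: `cos (θ/4) = 0` would force `cos
  -- (θ/2) = -1`.
  by_cases h : Real.cos (θ / 2) = 0
  · obtain ⟨V, hV⟩ := base (θ / 2) (by
      intro h2
      have h3 := hc (θ / 2)
      have h4 := Real.sin_sq_add_cos_sq (θ / 2 / 2)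
      rw [h2] at h3 h4
      nlinarith)
    refine ⟨_, (hV.trans hV).congr (funext fun z => ?_)⟩
    simp only [rotation, Function.comp_apply, hs θ, hc θ, Prod.mk.injEq]
    constructor <;> ring
  · exact base θ h

/-! ## The harmonic oscillator and bounds on the Schwartz seminorms -/

theorem momentum_position (f : 𝓢(ℝ, ℂ)) :
    momentum (position f) = position (momentum f) - Complex.I • f := by
  ext x
  have h1 : ⇑(position f) = fun x : ℝ => (x : ℂ) * f x := funext (position_apply f)
  have hd : deriv (position f) x = 1 * f x + (x : ℂ) * deriv f x := by
    rw [h1]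
    exact ((Complex.ofRealCLM.hasDerivAt (x := x)).mul f.differentiableAt.hasDerivAt).deriv
  rw [momentum_apply, hd]
  simp only [sub_apply, smul_apply, position_apply, momentum_apply, smul_eq_mul]
  ring

theorem inner_position (f g : 𝓢(ℝ, ℂ)) :
    ⟪incl (position f), incl g⟫_ℂ = ⟪incl f, incl (position g)⟫_ℂ := by
  rw [inner_incl, inner_incl]
  congr 1
  ext x
  simp only [position_apply, map_mul, Complex.conj_ofReal]
  ring

theorem inner_momentum (f g : 𝓢(ℝ, ℂ)) :
    ⟪incl (momentum f), incl g⟫_ℂ = ⟪incl f, incl (momentum g)⟫_ℂ := by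
  rw [inner_incl, inner_incl]
  have h := SchwartzMap.integral_bilinear_deriv_right_eq_neg_left f g
    ((ContinuousLinearMap.mul ℝ ℂ).comp (Complex.conjCLE : ℂ →L[ℝ] ℂ))
  simp only [ContinuousLinearMap.comp_apply, ContinuousLinearEquiv.coe_coe, Complex.conjCLE_apply,
    ContinuousLinearMap.mul_apply'] at h
  have h1 : ∀ x, conj (momentum f x) * g x = Complex.I * (conj (deriv f x) * g x) := fun x => by
    simp only [momentum_apply, map_mul, map_neg, Complex.conj_I]
    ring
  have h2 : ∀ x, conj (f x) * momentum g x = -Complex.I * (conj (f x) * deriv g x) := fun x => by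
    rw [momentum_apply]
    ring
  simp only [h1, h2]
  rw [integral_const_mul, integral_const_mul, h]
  ring

/-- The operator `Q² + P² + 1`. -/
def oscillator : 𝓢(ℝ, ℂ) →L[ℂ] 𝓢(ℝ, ℂ) :=
  position ∘L position + momentum ∘L momentum + ContinuousLinearMap.id ℂ _

theorem oscillator_apply (f : 𝓢(ℝ, ℂ)) :
    oscillator f = position (position f) + momentum (momentum f) + f := rfl

theorem oscillator_position (f : 𝓢(ℝ, ℂ)) :
    oscillator (position f) = position (oscillator f) - (2 * Complex.I) • momentum f := by
  simp only [oscillator_apply, momentum_position, map_add, map_sub, map_smul]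
  module

theorem oscillator_momentum (f : 𝓢(ℝ, ℂ)) :
    oscillator (momentum f) = momentum (oscillator f) + (2 * Complex.I) • position f := by
  simp only [oscillator_apply, momentum_position, map_add, map_sub, map_smul]
  module

theorem re_inner_oscillator (f : 𝓢(ℝ, ℂ)) :
    (⟪incl f, incl (oscillator f)⟫_ℂ).re =
      ‖incl (position f)‖ ^ 2 + ‖incl (momentum f)‖ ^ 2 + ‖incl f‖ ^ 2 := by
  rw [oscillator_apply, map_add, map_add, inner_add_right, inner_add_right, ← inner_position,
    ← inner_momentum, inner_self_eq_norm_sq_to_K, inner_self_eq_norm_sq_to_K,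
    inner_self_eq_norm_sq_to_K]
  norm_cast

/-- Cauchy–Schwarz applied to the quadratic form of the oscillator. The summand `‖f‖²`, due to the
`+ 1`, is what gives `‖f‖ ≤ ‖(Q² + P² + 1) f‖`. -/
theorem sq_norms_le (f : 𝓢(ℝ, ℂ)) :
    ‖incl (position f)‖ ^ 2 + ‖incl (momentum f)‖ ^ 2 + ‖incl f‖ ^ 2 ≤
      ‖incl f‖ * ‖incl (oscillator f)‖ := by
  rw [← re_inner_oscillator]
  exact (Complex.re_le_norm _).trans (norm_inner_le_norm _ _)

theorem norm_le_norm_oscillator (f : 𝓢(ℝ, ℂ)) : ‖incl f‖ ≤ ‖incl (oscillator f)‖ := by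
  have h := sq_norms_le f
  by_contra! hlt
  have h1 : 0 ≤ ‖incl (oscillator f)‖ := norm_nonneg _
  nlinarith [sq_nonneg ‖incl (position f)‖, sq_nonneg ‖incl (momentum f)‖]

theorem norm_position_le (f : 𝓢(ℝ, ℂ)) : ‖incl (position f)‖ ≤ ‖incl (oscillator f)‖ := by
  have h := sq_norms_le f
  refine (sq_le_sq₀ (norm_nonneg _) (norm_nonneg _)).1 ?_
  nlinarith [sq_nonneg ‖incl f‖, sq_nonneg ‖incl (momentum f)‖, norm_le_norm_oscillator f,
    norm_nonneg (incl (oscillator f))]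

theorem norm_momentum_le (f : 𝓢(ℝ, ℂ)) : ‖incl (momentum f)‖ ≤ ‖incl (oscillator f)‖ := by
  have h := sq_norms_le f
  refine (sq_le_sq₀ (norm_nonneg _) (norm_nonneg _)).1 ?_
  nlinarith [sq_nonneg ‖incl f‖, sq_nonneg ‖incl (position f)‖, norm_le_norm_oscillator f,
    norm_nonneg (incl (oscillator f))]

theorem norm_iterate_oscillator_le (r : ℕ) (f : 𝓢(ℝ, ℂ)) :
    ‖incl (oscillator^[r] f)‖ ≤ ‖incl (oscillator^[r + 1] f)‖ := by
  rw [Function.iterate_succ_apply']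
  exact norm_le_norm_oscillator _

theorem norm_iterate_oscillator_mono {r s : ℕ} (h : r ≤ s) (f : 𝓢(ℝ, ℂ)) :
    ‖incl (oscillator^[r] f)‖ ≤ ‖incl (oscillator^[s] f)‖ :=
  monotone_nat_of_le_succ (f := fun r => ‖incl (oscillator^[r] f)‖)
    (fun r => norm_iterate_oscillator_le r f) h

/-- Commuting one oscillator past `Q` or `P` produces `2 P` or `2 Q` up to a phase, so each step
costs a factor `1 + 2 = 3`. -/
theorem norm_iterate_oscillator_position_momentum_le (n : ℕ) (f : 𝓢(ℝ, ℂ)) :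
    ‖incl (oscillator^[n] (position f))‖ ≤ 3 ^ n * ‖incl (oscillator^[n + 1] f)‖ ∧
      ‖incl (oscillator^[n] (momentum f))‖ ≤ 3 ^ n * ‖incl (oscillator^[n + 1] f)‖ := by
  induction n generalizing f with
  | zero => simpa using ⟨norm_position_le f, norm_momentum_le f⟩
  | succ n ih =>
    have e : ∀ g, oscillator^[n] g = (oscillator ^ n) g := fun g => by
      rw [FunLike.coe_pow_eq_iterate]
    have h1 := (ih (oscillator f)).1
    have h2 := (ih (oscillator f)).2
    have h3 := (ih f).1
    have h4 := (ih f).2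
    have h5 := norm_iterate_oscillator_le (n + 1) f
    rw [← Function.iterate_succ_apply] at h1 h2
    have h6 : (0 : ℝ) ≤ 3 ^ n := by positivity
    have h7 : ‖2 * Complex.I‖ = 2 := by simp
    constructor
    · rw [Function.iterate_succ_apply, oscillator_position, e, map_sub, map_smul, ← e, ← e,
        map_sub, map_smul]
      refine (norm_sub_le _ _).trans ?_
      rw [norm_smul, h7, pow_succ]
      nlinarith
    · rw [Function.iterate_succ_apply, oscillator_momentum, e, map_add, map_smul, ← e, ← e,
        map_add, map_smul]
      refine (norm_add_le _ _).trans ?_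
      rw [norm_smul, h7, pow_succ]
      nlinarith

/-- The operator `A` is bounded, for the `L²` norm, by a power of the oscillator. -/
def OscillatorBounded (A : 𝓢(ℝ, ℂ) → 𝓢(ℝ, ℂ)) : Prop :=
  ∃ (C : ℝ) (r : ℕ), 0 ≤ C ∧ ∀ f, ‖incl (A f)‖ ≤ C * ‖incl (oscillator^[r] f)‖

theorem OscillatorBounded.comp_position {A : 𝓢(ℝ, ℂ) → 𝓢(ℝ, ℂ)} (hA : OscillatorBounded A) :
    OscillatorBounded (fun f => A (position f)) := by
  obtain ⟨C, r, hC, h⟩ := hA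
  refine ⟨C * 3 ^ r, r + 1, by positivity, fun f => (h _).trans ?_⟩
  rw [mul_assoc]
  exact mul_le_mul_of_nonneg_left (norm_iterate_oscillator_position_momentum_le r f).1 hC

theorem OscillatorBounded.comp_momentum {A : 𝓢(ℝ, ℂ) → 𝓢(ℝ, ℂ)} (hA : OscillatorBounded A) :
    OscillatorBounded (fun f => A (momentum f)) := by
  obtain ⟨C, r, hC, h⟩ := hA
  refine ⟨C * 3 ^ r, r + 1, by positivity, fun f => (h _).trans ?_⟩
  rw [mul_assoc]
  exact mul_le_mul_of_nonneg_left (norm_iterate_oscillator_position_momentum_le r f).2 hC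

theorem OscillatorBounded.comp_iterate_position {A : 𝓢(ℝ, ℂ) → 𝓢(ℝ, ℂ)}
    (hA : OscillatorBounded A) (k : ℕ) : OscillatorBounded (fun f => A (position^[k] f)) := by
  induction k with
  | zero => exact hA
  | succ k ih => exact ih.comp_position

theorem OscillatorBounded.comp_iterate_momentum {A : 𝓢(ℝ, ℂ) → 𝓢(ℝ, ℂ)}
    (hA : OscillatorBounded A) (k : ℕ) : OscillatorBounded (fun f => A (momentum^[k] f)) := by
  induction k with
  | zero => exact hA
  | succ k ih => exact ih.comp_momentum

theorem oscillatorBounded_id : OscillatorBounded (fun f => f) :=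
  ⟨1, 0, zero_le_one, fun f => by simp⟩

theorem OscillatorBounded.add {A B : 𝓢(ℝ, ℂ) → 𝓢(ℝ, ℂ)} (hA : OscillatorBounded A)
    (hB : OscillatorBounded B) : OscillatorBounded (fun f => A f + B f) := by
  obtain ⟨C, r, hC, h⟩ := hA
  obtain ⟨C', r', hC', h'⟩ := hB
  refine ⟨C + C', max r r', by positivity, fun f => ?_⟩
  rw [map_add, add_mul]
  refine (norm_add_le _ _).trans (add_le_add ((h f).trans ?_) ((h' f).trans ?_))
  · exact mul_le_mul_of_nonneg_left (norm_iterate_oscillator_mono (le_max_left _ _) f) hC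
  · exact mul_le_mul_of_nonneg_left (norm_iterate_oscillator_mono (le_max_right _ _) f) hC'

theorem memLp_inv_one_add_sq : MemLp (fun x : ℝ => (1 + x ^ 2)⁻¹) 2 volume := by
  have hc : Continuous fun x : ℝ => (1 + x ^ 2)⁻¹ :=
    Continuous.inv₀ (by fun_prop) fun x => by positivity
  rw [memLp_two_iff_integrable_sq hc.aestronglyMeasurable]
  refine integrable_inv_one_add_sq.mono (hc.pow 2).aestronglyMeasurable
    (Filter.Eventually.of_forall fun x => ?_)
  have h1 : (1 + x ^ 2)⁻¹ ≤ 1 := inv_le_one_of_one_le₀ (by nlinarith [sq_nonneg x])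
  have h0 : 0 ≤ (1 + x ^ 2)⁻¹ := by positivity
  rw [Real.norm_of_nonneg (by positivity), Real.norm_of_nonneg h0]
  nlinarith

/-- One-dimensional Sobolev inequality: `f x` is the integral of `f'` over `(-∞, x]`, and
Cauchy–Schwarz applies to `f' = (1 + y²)⁻¹ · (1 + y²) f'`, the first factor being in `L²`. -/
theorem exists_norm_apply_le :
    ∃ C : ℝ, 0 ≤ C ∧ ∀ (f : 𝓢(ℝ, ℂ)) (x : ℝ),
      ‖f x‖ ≤ C * ‖incl (momentum f + position (position (momentum f)))‖ := by
  refine ⟨(eLpNorm (fun x : ℝ => (1 + x ^ 2)⁻¹) 2 volume).toReal, ENNReal.toReal_nonneg,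
    fun f x => ?_⟩
  set g := momentum f + position (position (momentum f)) with hg
  have hfun : ⇑(momentum f) = (fun x : ℝ => (1 + x ^ 2)⁻¹) • ⇑g := by
    ext y
    have hy : (1 + (y : ℂ) ^ 2) ≠ 0 := by
      have : (1 + y ^ 2 : ℝ) ≠ 0 := by positivity
      exact_mod_cast this
    simp only [hg, Pi.smul_apply', add_apply, position_apply, Complex.real_smul]
    push_cast
    field_simp
  have hint : Integrable (momentum f) := (momentum f).integrable
  have hd : ∀ y, HasDerivAt f (Complex.I * momentum f y) y := fun y => by
    have := f.differentiableAt.hasDerivAt (x := y)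
    refine this.congr_deriv ?_
    rw [momentum_apply, ← mul_assoc]
    simp
  have h0 : Filter.Tendsto f Filter.atBot (nhds 0) :=
    f.tendsto_cocompact.mono_left (by rw [cocompact_eq_atBot_atTop]; exact le_sup_left)
  have h1 := integral_Iic_of_hasDerivAt_of_tendsto' (a := x) (fun y _ => hd y)
    (hint.const_mul Complex.I).integrableOn h0
  rw [sub_zero] at h1
  have h2 : ‖f x‖ ≤ ∫ y, ‖momentum f y‖ := by
    rw [← h1]
    refine (norm_integral_le_integral_norm _).trans ?_
    simp only [norm_mul, Complex.norm_I, one_mul]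
    exact setIntegral_le_integral hint.norm (Filter.Eventually.of_forall fun y => norm_nonneg _)
  refine h2.trans ?_
  have hL2 : eLpNorm g 2 volume ≠ ⊤ := (g.memLp 2 volume).2.ne
  have h3 := eLpNorm_smul_le_mul_eLpNorm (p := 2) (q := 2) (r := 1) (μ := (volume : Measure ℝ))
    (g.memLp 2 volume).1 memLp_inv_one_add_sq.1
  rw [← hfun] at h3
  rw [integral_norm_eq_lintegral_enorm hint.1, ← eLpNorm_one_eq_lintegral_enorm, norm_incl_eq,
    ← ENNReal.toReal_mul]
  exact ENNReal.toReal_mono (ENNReal.mul_ne_top memLp_inv_one_add_sq.2.ne hL2) h3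

theorem iteratedDeriv_eq_momentum (n : ℕ) (f : 𝓢(ℝ, ℂ)) :
    iteratedDeriv n f = fun x => Complex.I ^ n * momentum^[n] f x := by
  induction n with
  | zero => simp
  | succ n ih =>
    ext x
    rw [iteratedDeriv_succ, ih, deriv_const_mul _ (momentum^[n] f).differentiableAt,
      Function.iterate_succ_apply', momentum_apply, pow_succ]
    linear_combination (Complex.I ^ n * deriv (momentum^[n] f) x) * Complex.I_sq

theorem iterate_position_apply (k : ℕ) (f : 𝓢(ℝ, ℂ)) (x : ℝ) :
    position^[k] f x = (x : ℂ) ^ k * f x := by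
  induction k generalizing f with
  | zero => simp
  | succ k ih => rw [Function.iterate_succ_apply, ih, position_apply, pow_succ, mul_assoc]

/-- The Sobolev bound is applied to `x^k P^n f`, and the resulting monomials in `Q` and `P` are
absorbed into a power of the oscillator. -/
theorem seminorm_le_norm_iterate_oscillator (k n : ℕ) :
    ∃ (C : ℝ) (r : ℕ), 0 ≤ C ∧
      ∀ f : 𝓢(ℝ, ℂ), SchwartzMap.seminorm ℂ k n f ≤ C * ‖incl (oscillator^[r] f)‖ := by
  obtain ⟨C, hC, h⟩ := exists_norm_apply_le
  -- Each `comp_` inserts its operator innermost, so the chain reads from the outermost operator to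
  -- the one acting first.
  have hb := ((oscillatorBounded_id.comp_momentum.add
    ((oscillatorBounded_id.comp_iterate_position 2).comp_momentum)).comp_iterate_position
      k).comp_iterate_momentum n
  obtain ⟨C', r, hC', h'⟩ := hb
  refine ⟨C * C', r, by positivity, fun f => ?_⟩
  refine SchwartzMap.seminorm_le_bound' ℂ k n f (by positivity) fun x => ?_
  have h1 := h (position^[k] (momentum^[n] f)) x
  have h2 := h' f
  rw [iterate_position_apply] at h1
  rw [iteratedDeriv_eq_momentum, mul_assoc]
  simp only [norm_mul, norm_pow, Complex.norm_I, one_pow, one_mul, Complex.norm_real,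
    Real.norm_eq_abs] at h1 ⊢
  exact h1.trans (mul_le_mul_of_nonneg_left h2 hC)

/-- Continuity on the Schwartz space bounds `F` by finitely many seminorms. Since the oscillator
norms increase with the power, a single power dominates them all. -/
theorem ket_bound (F : Ket) :
    ∃ (C : ℝ) (r : ℕ), 0 ≤ C ∧ ∀ f : 𝓢(ℝ, ℂ), ‖F f‖ ≤ C * ‖incl (oscillator^[r] f)‖ := by
  have hq : Continuous ((normSeminorm ℂ ℂ).comp F.toLinearMap) :=
    continuous_norm.comp F.continuous
  obtain ⟨s, C, -, hle⟩ := Seminorm.bound_of_continuous (schwartz_withSeminorms ℂ ℝ ℂ) _ hq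
  have key : ∀ t : Finset (ℕ × ℕ), ∃ (C : ℝ) (r : ℕ), 0 ≤ C ∧ ∀ f : 𝓢(ℝ, ℂ),
      (t.sup (schwartzSeminormFamily ℂ ℝ ℂ)) f ≤ C * ‖incl (oscillator^[r] f)‖ := by
    intro t
    induction t using Finset.induction_on with
    | empty => exact ⟨0, 0, le_rfl, fun f => by simp⟩
    | insert a t _ ih =>
      obtain ⟨C₁, r₁, hC₁, h₁⟩ := seminorm_le_norm_iterate_oscillator a.1 a.2
      obtain ⟨C₂, r₂, hC₂, h₂⟩ := ih
      refine ⟨C₁ + C₂, max r₁ r₂, by positivity, fun f => ?_⟩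
      rw [Finset.sup_insert]
      have hm₁ := norm_iterate_oscillator_mono (le_max_left r₁ r₂) f
      have hm₂ := norm_iterate_oscillator_mono (le_max_right r₁ r₂) f
      have h0 := norm_nonneg (incl (oscillator^[max r₁ r₂] f))
      refine max_le ((h₁ f).trans ?_) ((h₂ f).trans ?_) <;> nlinarith
  obtain ⟨C', r, hC', h'⟩ := key s
  refine ⟨C * C', r, by positivity, fun f => (hle f).trans ?_⟩
  rw [mul_assoc]
  exact mul_le_mul_of_nonneg_left (h' f) C.2

/-! ## Number states -/

theorem creation_apply (f : 𝓢(ℝ, ℂ)) :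
    creation f = (((√2)⁻¹ : ℝ) : ℂ) • (position f - Complex.I • momentum f) := rfl

/-- The annihilation operator `a = (Q + i P) / √2` on the Schwartz space. -/
def annihilation : 𝓢(ℝ, ℂ) →L[ℂ] 𝓢(ℝ, ℂ) :=
  (((√2)⁻¹ : ℝ) : ℂ) • (position + Complex.I • momentum)

theorem annihilation_apply (f : 𝓢(ℝ, ℂ)) :
    annihilation f = (((√2)⁻¹ : ℝ) : ℂ) • (position f + Complex.I • momentum f) := rfl

theorem inv_sqrt_two_mul_self : (((√2)⁻¹ : ℝ) : ℂ) * (((√2)⁻¹ : ℝ) : ℂ) = 1 / 2 := by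
  rw [← Complex.ofReal_mul, ← mul_inv, Real.mul_self_sqrt zero_le_two]
  norm_num

theorem inv_sqrt_two_ne_zero : (((√2)⁻¹ : ℝ) : ℂ) ≠ 0 := by
  simp

theorem annihilation_creation (f : 𝓢(ℝ, ℂ)) :
    annihilation (creation f) = creation (annihilation f) + f := by
  simp only [annihilation_apply, creation_apply, map_smul, map_sub, map_add, momentum_position]
  ext x
  simp only [add_apply, sub_apply, smul_apply, smul_eq_mul]
  linear_combination (-2 * Complex.I ^ 2 * f x) * inv_sqrt_two_mul_self - f x * Complex.I_sq

theorem oscillator_creation (f : 𝓢(ℝ, ℂ)) :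
    oscillator (creation f) = creation (oscillator f) + (2 : ℂ) • creation f := by
  simp only [creation_apply, map_smul, map_sub, oscillator_position, oscillator_momentum]
  ext x
  simp only [add_apply, sub_apply, smul_apply, smul_eq_mul]
  linear_combination (-2 * (((√2)⁻¹ : ℝ) : ℂ) * position f x) * Complex.I_sq

theorem deriv_vacuum (x : ℝ) : deriv vacuum x = -(x : ℂ) * vacuum x := by
  have h1 : ⇑vacuum = fun x : ℝ =>
      ((Real.pi ^ (-(1 / 4) : ℝ) * Real.exp (-(x ^ 2 / 2)) : ℝ) : ℂ) := funext vacuum_apply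
  have h2 : HasDerivAt (fun x : ℝ => Real.pi ^ (-(1 / 4) : ℝ) * Real.exp (-(x ^ 2 / 2)))
      (-x * (Real.pi ^ (-(1 / 4) : ℝ) * Real.exp (-(x ^ 2 / 2)))) x := by
    have h3 : HasDerivAt (fun x : ℝ => -(x ^ 2 / 2)) (-x) x := by
      refine ((hasDerivAt_pow 2 x).div_const 2).fun_neg.congr_deriv ?_
      norm_num
    refine (h3.exp.const_mul _).congr_deriv ?_
    ring
  rw [h1, h2.ofReal_comp.deriv]
  push_cast
  ring

theorem vacuum_ne_zero (x : ℝ) : vacuum x ≠ 0 := by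
  rw [vacuum_apply]
  have : 0 < Real.pi ^ (-(1 / 4) : ℝ) * Real.exp (-(x ^ 2 / 2)) := by positivity
  exact_mod_cast this.ne'

theorem annihilation_vacuum : annihilation vacuum = 0 := by
  ext x
  rw [annihilation_apply]
  simp only [add_apply, smul_apply, smul_eq_mul, position_apply, momentum_apply, deriv_vacuum,
    zero_apply]
  linear_combination ((((√2)⁻¹ : ℝ) : ℂ) * x * vacuum x) * Complex.I_sq

/-- The equation reads `f' = -x f`, so `f / vacuum` has zero derivative. -/
theorem eq_smul_vacuum_of_annihilation_eq_zero {f : 𝓢(ℝ, ℂ)} (hf : annihilation f = 0) :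
    ∃ c : ℂ, f = c • vacuum := by
  have hf' : ∀ x, deriv f x = -(x : ℂ) * f x := by
    intro x
    have h := congrArg (fun g : 𝓢(ℝ, ℂ) => g x) hf
    rw [annihilation_apply] at h
    simp only [add_apply, smul_apply, smul_eq_mul, position_apply, momentum_apply,
      zero_apply, mul_eq_zero, inv_sqrt_two_ne_zero, false_or] at h
    linear_combination h + deriv f x * Complex.I_sq
  have hd : ∀ x, HasDerivAt (fun x => f x / vacuum x) 0 x := by
    intro x
    refine (f.differentiableAt.hasDerivAt.fun_div vacuum.differentiableAt.hasDerivAt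
      (vacuum_ne_zero x)).congr_deriv ?_
    rw [hf', deriv_vacuum]
    ring
  refine ⟨f 0 / vacuum 0, ?_⟩
  ext x
  have h := is_const_of_deriv_eq_zero (fun x => (hd x).differentiableAt)
    (fun x => (hd x).deriv) x 0
  rw [smul_apply, smul_eq_mul, ← h, div_mul_cancel₀ _ (vacuum_ne_zero x)]

theorem oscillator_eq (f : 𝓢(ℝ, ℂ)) :
    oscillator f = (2 : ℂ) • creation (annihilation f) + (2 : ℂ) • f := by
  simp only [annihilation_apply, creation_apply, map_smul, map_add, momentum_position,
    oscillator_apply]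
  ext x
  simp only [add_apply, sub_apply, smul_apply, smul_eq_mul]
  linear_combination (-2 * (position (position f) x + Complex.I ^ 2 * f x -
    Complex.I ^ 2 * momentum (momentum f) x)) * inv_sqrt_two_mul_self +
    (-f x + momentum (momentum f) x) * Complex.I_sq

theorem oscillator_iterate_creation (n : ℕ) :
    oscillator (creation^[n] vacuum) = (2 * n + 2 : ℂ) • creation^[n] vacuum := by
  induction n with
  | zero => simp [oscillator_eq, annihilation_vacuum]
  | succ n ih =>
    rw [Function.iterate_succ_apply', oscillator_creation, ih, map_smul, ← add_smul]
    push_cast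
    congr 1
    ring

theorem annihilation_iterate_creation (n : ℕ) :
    annihilation (creation^[n + 1] vacuum) = (n + 1 : ℂ) • creation^[n] vacuum := by
  induction n with
  | zero => simp [annihilation_creation, annihilation_vacuum]
  | succ n ih =>
    rw [Function.iterate_succ_apply', annihilation_creation, ih, map_smul,
      ← Function.iterate_succ_apply' creation]
    push_cast
    module

theorem iterate_creation_vacuum_apply (n : ℕ) (x : ℝ) :
    creation^[n] vacuum x = ((Real.pi ^ (-(1 / 4) : ℝ) * (√2)⁻¹ ^ n * (hermiteH n).eval x *
      Real.exp (-(x ^ 2 / 2)) : ℝ) : ℂ) := by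
  induction n generalizing x with
  | zero => simp [vacuum_apply, hermiteH]
  | succ n ih =>
    have h2 : HasDerivAt (fun x : ℝ => Real.pi ^ (-(1 / 4) : ℝ) * (√2)⁻¹ ^ n *
        (hermiteH n).eval x * Real.exp (-(x ^ 2 / 2)))
        (Real.pi ^ (-(1 / 4) : ℝ) * (√2)⁻¹ ^ n * (hermiteH n).derivative.eval x *
          Real.exp (-(x ^ 2 / 2)) + Real.pi ^ (-(1 / 4) : ℝ) * (√2)⁻¹ ^ n *
          (hermiteH n).eval x * (Real.exp (-(x ^ 2 / 2)) * -x)) x := by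
      have h3 : HasDerivAt (fun x : ℝ => -(x ^ 2 / 2)) (-x) x := by
        refine ((hasDerivAt_pow 2 x).div_const 2).fun_neg.congr_deriv ?_
        norm_num
      exact (((hermiteH n).hasDerivAt x).const_mul _).fun_mul h3.exp
    have h4 := h2.ofReal_comp.deriv
    rw [← funext ih] at h4
    rw [Function.iterate_succ_apply', creation_apply]
    simp only [sub_apply, smul_apply, smul_eq_mul, position_apply, momentum_apply, h4, ih, hermiteH,
      Polynomial.eval_sub, Polynomial.eval_mul, Polynomial.eval_X, Polynomial.eval_ofNat, pow_succ]
    have hI : Complex.I * Complex.I = -1 := Complex.I_mul_I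
    rw [← mul_assoc Complex.I, mul_neg, hI, neg_neg, one_mul]
    push_cast
    ring

theorem numberState_mul_exp_eq_hermiteCoeff (θ : ℝ) (n : ℕ) (x : ℝ) :
    numberState n x * Complex.exp (-(Complex.I * (n : ℂ) * (θ : ℂ))) = hermiteCoeff θ x n := by
  rw [numberState, smul_apply, iterate_creation_vacuum_apply, hermiteCoeff, smul_eq_mul,
    ← Complex.ofReal_mul]
  congr 2
  have h1 : (2 : ℝ) ^ ((n : ℝ) / 2) = √2 ^ n := by
    rw [Real.sqrt_eq_rpow, ← Real.rpow_natCast, ← Real.rpow_mul zero_le_two]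
    congr 1
    ring
  rw [h1, ← Real.sqrt_eq_rpow, inv_pow, Real.rpow_neg Real.pi_pos.le, neg_div]
  field_simp

/-- The linear span of the number states. -/
def numberSpan : Submodule ℂ 𝓢(ℝ, ℂ) :=
  Submodule.span ℂ (Set.range fun n => creation^[n] vacuum)

theorem iterate_creation_mem (n : ℕ) : creation^[n] vacuum ∈ numberSpan :=
  Submodule.subset_span ⟨n, rfl⟩

/-- `Q = (a† + a) / √2`, and both ladder operators preserve the span. Hence all polynomials times
the Gaussian belong to it. -/
theorem position_mem_numberSpan {f : 𝓢(ℝ, ℂ)} (hf : f ∈ numberSpan) :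
    position f ∈ numberSpan := by
  have hpos : ∀ g, position g = (((√2)⁻¹ : ℝ) : ℂ) • (creation g + annihilation g) := by
    intro g
    rw [creation_apply, annihilation_apply]
    ext x
    simp only [add_apply, sub_apply, smul_apply, smul_eq_mul]
    linear_combination (-2 * position g x) * inv_sqrt_two_mul_self
  induction hf using Submodule.span_induction with
  | mem f h =>
    obtain ⟨n, rfl⟩ := h
    rw [hpos]
    refine Submodule.smul_mem _ _ (Submodule.add_mem _ ?_ ?_)
    · simp only [← Function.iterate_succ_apply' creation]
      exact iterate_creation_mem _
    · rcases n with _ | n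
      · simp [annihilation_vacuum]
      · simp only [annihilation_iterate_creation]
        exact Submodule.smul_mem _ _ (iterate_creation_mem _)
  | zero => simp
  | add f g _ _ hf hg => rw [map_add]; exact Submodule.add_mem _ hf hg
  | smul c f _ hf => rw [map_smul]; exact Submodule.smul_mem _ _ hf

theorem iterate_position_vacuum_mem (k : ℕ) : position^[k] vacuum ∈ numberSpan := by
  induction k with
  | zero => exact iterate_creation_mem 0
  | succ k ih => rw [Function.iterate_succ_apply']; exact position_mem_numberSpan ih

/-- The oscillator is diagonal on the number states with eigenvalues `2 n + 2 ≠ 0`, so it can be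
inverted within the span. -/
theorem exists_oscillator_eq {f : 𝓢(ℝ, ℂ)} (hf : f ∈ numberSpan) :
    ∃ g ∈ numberSpan, oscillator g = f := by
  induction hf using Submodule.span_induction with
  | mem f h =>
    obtain ⟨n, rfl⟩ := h
    refine ⟨(2 * n + 2 : ℂ)⁻¹ • creation^[n] vacuum,
      Submodule.smul_mem _ _ (iterate_creation_mem _), ?_⟩
    have : (2 * n + 2 : ℂ) ≠ 0 := by
      have : (2 * n + 2 : ℝ) ≠ 0 := by positivity
      exact_mod_cast this
    rw [map_smul, oscillator_iterate_creation, smul_smul, inv_mul_cancel₀ this, one_smul]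
  | zero => exact ⟨0, Submodule.zero_mem _, map_zero _⟩
  | add f g _ _ hf hg =>
    obtain ⟨f', hf', rfl⟩ := hf
    obtain ⟨g', hg', rfl⟩ := hg
    exact ⟨f' + g', Submodule.add_mem _ hf' hg', map_add _ _ _⟩
  | smul c f _ hf =>
    obtain ⟨f', hf', rfl⟩ := hf
    exact ⟨c • f', Submodule.smul_mem _ _ hf', map_smul _ _ _⟩

theorem exists_iterate_oscillator_eq (r : ℕ) {f : 𝓢(ℝ, ℂ)} (hf : f ∈ numberSpan) :
    ∃ g ∈ numberSpan, oscillator^[r] g = f := by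
  induction r with
  | zero => exact ⟨f, hf, rfl⟩
  | succ r ih =>
    obtain ⟨g, hg, rfl⟩ := ih
    obtain ⟨g', hg', rfl⟩ := exists_oscillator_eq hg
    exact ⟨g', hg', Function.iterate_succ_apply _ _ _⟩

/-! ## Completeness of the number states -/

/-- Each test function is the Fourier transform of a Schwartz function; moving the transform onto
`w` shows that `w` vanishes as a tempered distribution. -/
theorem ae_eq_zero_of_fourier_eq_zero {w : ℝ → ℂ} (hw : Integrable w) (h : ∀ t, 𝓕 w t = 0) :
    w =ᵐ[volume] 0 := by
  have h1 : Lp.toTemperedDistribution (hw.toL1) = 0 := by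
    ext φ
    have e : ∫ x, φ x • hw.toL1 w x = ∫ x, φ x • w x := by
      refine integral_congr_ae ?_
      filter_upwards [hw.coeFn_toL1] with x hx
      rw [hx]
    rw [Lp.toTemperedDistribution_apply, e]
    let ψ : 𝓢(ℝ, ℂ) := 𝓕⁻ φ
    have h2 := VectorFourier.integral_fourierIntegral_smul_eq_flip (L := innerₗ ℝ)
      (μ := (volume : Measure ℝ)) (ν := (volume : Measure ℝ)) (f := ψ) (g := w)
      Real.continuous_fourierChar continuous_inner ψ.integrable hw
    have h3 : ∀ x, VectorFourier.fourierIntegral Real.fourierChar volume (innerₗ ℝ) ψ x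
        = φ x := fun x => by
      change 𝓕 ψ x = φ x
      simp [ψ]
    have h4 : ∀ x, VectorFourier.fourierIntegral Real.fourierChar volume (innerₗ ℝ).flip w x
        = 0 := fun x => by
      rw [flip_innerₗ]
      exact h x
    simp only [h3, h4] at h2
    simpa using h2
  have h2 : hw.toL1 ∈ (Lp.toTemperedDistributionCLM ℂ (volume : Measure ℝ) 1).ker := h1
  rw [Lp.ker_toTemperedDistributionCLM_eq_bot, Submodule.mem_bot] at h2
  have h3 := hw.coeFn_toL1
  rw [h2] at h3
  exact h3.symm.trans (Lp.coeFn_zero ℂ 1 volume)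

theorem memLp_exp_mul_abs_mul_exp (t : ℝ) :
    MemLp (fun x : ℝ => Real.exp (|t * x|) * Real.exp (-(x ^ 2 / 2))) 2 volume := by
  have hc : Continuous fun x : ℝ => Real.exp (|t * x|) * Real.exp (-(x ^ 2 / 2)) := by fun_prop
  rw [memLp_two_iff_integrable_sq hc.aestronglyMeasurable]
  refine ((integrable_exp_neg_mul_sq (b := 1 / 2) (by norm_num)).const_mul
    (Real.exp (2 * t ^ 2))).mono (hc.pow 2).aestronglyMeasurable
    (Filter.Eventually.of_forall fun x => ?_)
  rw [Real.norm_of_nonneg (by positivity), Real.norm_of_nonneg (by positivity), ← Real.exp_add,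
    ← Real.exp_add, ← Real.exp_nat_mul, Real.exp_le_exp, abs_mul]
  have := sq_nonneg (|x| / 2 - |t|)
  have h1 := sq_abs x
  have h2 := sq_abs t
  push_cast
  nlinarith

/-- All moments of `w = vacuum · g` vanish. The Gaussian factor gives `w` exponential moments, so
the power series of the Fourier kernel may be integrated term by term, and `𝓕 w = 0`. -/
theorem eq_zero_of_inner_numberSpan {g : Hilb} (hg : ∀ f ∈ numberSpan, ⟪incl f, g⟫_ℂ = 0) :
    g = 0 := by
  set w : ℝ → ℂ := fun x => vacuum x * g x with hw
  have hmom : ∀ k : ℕ, ∫ x : ℝ, (x : ℂ) ^ k * w x = 0 := by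
    intro k
    have h1 := hg _ (iterate_position_vacuum_mem k)
    rw [L2.inner_def] at h1
    rw [← h1]
    refine integral_congr_ae ?_
    filter_upwards [coeFn_incl (position^[k] vacuum)] with x hx
    rw [hx, iterate_position_apply, vacuum_apply, RCLike.inner_apply, map_mul, map_pow,
      Complex.conj_ofReal, Complex.conj_ofReal, hw]
    simp only [vacuum_apply]
    ring
  have hwm : AEStronglyMeasurable w volume :=
    vacuum.continuous.aestronglyMeasurable.mul (Lp.aestronglyMeasurable g)
  have hexp : ∀ t : ℝ, Integrable (fun x : ℝ => Real.exp (|t * x|) * ‖w x‖) := by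
    intro t
    have h1 := ((memLp_exp_mul_abs_mul_exp t).integrable_mul (Lp.memLp g).norm).const_mul
      (Real.pi ^ (-(1 / 4) : ℝ))
    refine h1.congr (Filter.Eventually.of_forall fun x => ?_)
    have h2 : 0 ≤ Real.pi ^ (-(1 / 4) : ℝ) * Real.exp (-(x ^ 2 / 2)) := by positivity
    simp only [hw, norm_mul, vacuum_apply, Complex.norm_real, Pi.mul_apply]
    rw [Real.norm_of_nonneg (by positivity), Real.norm_of_nonneg (by positivity)]
    ring
  have hwi : Integrable w := by
    refine (hexp 0).mono' hwm (Filter.Eventually.of_forall fun x => ?_)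
    simp
  have hF : ∀ t, 𝓕 w t = 0 := by
    intro t
    rw [Real.fourier_real_eq_integral_exp_smul]
    have h1 := hasSum_integral_of_dominated_convergence (μ := (volume : Measure ℝ))
      (F := fun (n : ℕ) (x : ℝ) =>
        ((n.factorial : ℂ)⁻¹ * ((-2 * Real.pi * t : ℝ) * Complex.I) ^ n) * ((x : ℂ) ^ n * w x))
      (f := fun x : ℝ => Complex.exp (((-2 * Real.pi * x * t : ℝ) : ℂ) * Complex.I) • w x)
      (fun n x => ((n.factorial : ℝ)⁻¹ * |(-2 * Real.pi * t) * x| ^ n) * ‖w x‖) ?_ ?_ ?_ ?_ ?_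
    · simp only [integral_const_mul, hmom, mul_zero] at h1
      exact h1.unique hasSum_zero
    · intro n
      have : Continuous fun x : ℝ => (x : ℂ) ^ n := by fun_prop
      exact (this.aestronglyMeasurable.mul hwm).const_mul _
    · refine fun n => Filter.Eventually.of_forall fun x => le_of_eq ?_
      simp only [norm_mul, norm_inv, norm_pow, Complex.norm_real, Complex.norm_I,
        Complex.norm_natCast, Real.norm_eq_abs, abs_mul, mul_pow]
      ring
    · refine Filter.Eventually.of_forall fun x => Summable.mul_right _ ?_
      simpa [div_eq_inv_mul] using Real.summable_pow_div_factorial |(-2 * Real.pi * t) * x|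
    · refine (hexp (-2 * Real.pi * t)).congr (Filter.Eventually.of_forall fun x => ?_)
      simp only [tsum_mul_right]
      congr 1
      rw [Real.exp_eq_exp_ℝ, NormedSpace.exp_eq_tsum_div]
      simp only [div_eq_inv_mul]
    · refine Filter.Eventually.of_forall fun x => ?_
      have h2 := NormedSpace.expSeries_div_hasSum_exp
        (((-2 * Real.pi * x * t : ℝ) : ℂ) * Complex.I)
      rw [← Complex.exp_eq_exp_ℂ] at h2
      have h3 := h2.mul_right (w x)
      rw [smul_eq_mul]
      refine h3.congr_fun fun n => ?_
      push_cast
      ring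
  have h0 := ae_eq_zero_of_fourier_eq_zero hwi hF
  rw [Lp.eq_zero_iff_ae_eq_zero]
  filter_upwards [h0] with x hx
  exact (mul_eq_zero.1 hx).resolve_left (vacuum_ne_zero x)

theorem dense_map_numberSpan :
    Dense ((numberSpan.map incl.toLinearMap : Submodule ℂ Hilb) : Set Hilb) := by
  rw [Submodule.dense_iff_topologicalClosure_eq_top, Submodule.topologicalClosure_eq_top_iff,
    Submodule.eq_bot_iff]
  intro g hg
  refine eq_zero_of_inner_numberSpan fun f hf => ?_
  exact (Submodule.mem_orthogonal _ _).1 hg _ ⟨f, hf, rfl⟩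

/-- With `N` the oscillator and `r` from `ket_bound`, approximate `N^r φ` in `L²` by an element `N^r
d'` with `d'` in the span. Then `F φ = F (φ - d')` is at most `C ‖N^r φ - N^r d'‖`. -/
theorem ket_eq_zero {F : Ket} (hF : ∀ n, F (numberState n) = 0) : F = 0 := by
  have hspan : ∀ f ∈ numberSpan, F f = 0 := by
    intro f hf
    induction hf using Submodule.span_induction with
    | mem f h =>
      obtain ⟨n, rfl⟩ := h
      have h1 := hF n
      rw [numberState, map_smulₛₗ, smul_eq_zero] at h1
      refine h1.resolve_left ?_
      have : √(n.factorial : ℝ) ≠ 0 := by positivity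
      simpa using this
    | zero => exact map_zero F
    | add f g _ _ hf hg => rw [map_add, hf, hg, add_zero]
    | smul c f _ hf => rw [map_smulₛₗ, hf, smul_zero]
  obtain ⟨C, r, hC, hb⟩ := ket_bound F
  ext φ
  rw [zero_apply, ← norm_le_zero_iff]
  refine le_of_forall_pos_le_add fun ε hε => ?_
  -- The denominator `C + 1` covers the case `C = 0`.
  obtain ⟨_, hdist, d, hd, rfl⟩ := Metric.dense_iff.1 dense_map_numberSpan
    (incl (oscillator^[r] φ)) (ε / (C + 1)) (by positivity)
  obtain ⟨d', hd', rfl⟩ := exists_iterate_oscillator_eq r hd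
  have h1 := hb (φ - d')
  have e : ∀ g, oscillator^[r] g = (oscillator ^ r) g := fun g => by
    rw [FunLike.coe_pow_eq_iterate]
  rw [map_sub, hspan d' hd', sub_zero, e, map_sub, ← e, ← e, map_sub] at h1
  rw [Metric.mem_ball, dist_comm, dist_eq_norm] at hdist
  change ‖incl (oscillator^[r] φ) - incl (oscillator^[r] d')‖ < _ at hdist
  rw [lt_div_iff₀ (by positivity)] at hdist
  nlinarith [norm_nonneg (incl (oscillator^[r] φ) - incl (oscillator^[r] d'))]

/-! ## Rotations act diagonally on the number states -/

namespace Implements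

variable {V : 𝓢(ℝ, ℂ) ≃L[ℂ] 𝓢(ℝ, ℂ)} {θ : ℝ}

theorem map_position (h : Implements V (rotation θ)) (f : 𝓢(ℝ, ℂ)) :
    V (position f) = (Real.cos θ : ℂ) • position (V f) - (Real.sin θ : ℂ) • momentum (V f) := by
  simpa [generator_apply, rotation] using h.map_generator (0, 1) f

theorem map_momentum (h : Implements V (rotation θ)) (f : 𝓢(ℝ, ℂ)) :
    V (momentum f) = (Real.sin θ : ℂ) • position (V f) + (Real.cos θ : ℂ) • momentum (V f) := by
  simpa [generator_apply, rotation] using h.map_generator (-1, 0) f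

/-- `Q_θ` is the generator in the direction `(-sin θ, cos θ)` of the segment, which the rotation
takes to the `p`-axis. -/
theorem map_quadratureCore (h : Implements V (rotation θ)) (f : 𝓢(ℝ, ℂ)) :
    V (quadratureCore θ f) = position (V f) := by
  have h1 : quadratureCore θ f = generator (-Real.sin θ, Real.cos θ) f := by
    simp [quadratureCore, generator_apply]
  have h2 : rotation θ (-Real.sin θ, Real.cos θ) = (0, 1) := by
    simp only [rotation, Prod.mk.injEq]
    constructor
    · ring
    · linear_combination Real.sin_sq_add_cos_sq θ
  rw [h1, h.map_generator, h2]
  simp [generator_apply]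

theorem map_creation (h : Implements V (rotation θ)) (f : 𝓢(ℝ, ℂ)) :
    V (creation f) = Complex.exp (-(Complex.I * θ)) • creation (V f) := by
  have he : Complex.exp (-(Complex.I * θ)) = Real.cos θ - Real.sin θ * Complex.I := by
    rw [show -(Complex.I * (θ : ℂ)) = ((-θ : ℝ) : ℂ) * Complex.I by push_cast; ring,
      Complex.exp_mul_I]
    simp [← Complex.ofReal_cos, ← Complex.ofReal_sin]
    ring
  rw [creation_apply, creation_apply, map_smul, map_sub, map_smul, h.map_position, h.map_momentum,
    he]
  ext x
  simp only [add_apply, sub_apply, smul_apply, smul_eq_mul]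
  linear_combination (-(((√2)⁻¹ : ℝ) : ℂ) * Real.sin θ * momentum (V f) x) * Complex.I_sq

theorem map_annihilation (h : Implements V (rotation θ)) (f : 𝓢(ℝ, ℂ)) :
    V (annihilation f) = Complex.exp (Complex.I * θ) • annihilation (V f) := by
  have he : Complex.exp (Complex.I * θ) = Real.cos θ + Real.sin θ * Complex.I := by
    rw [mul_comm, Complex.exp_mul_I]
    simp
  rw [annihilation_apply, annihilation_apply, map_smul, map_add, map_smul, h.map_position,
    h.map_momentum, he]
  ext x
  simp only [add_apply, sub_apply, smul_apply, smul_eq_mul]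
  linear_combination (-(((√2)⁻¹ : ℝ) : ℂ) * Real.sin θ * momentum (V f) x) * Complex.I_sq

theorem map_iterate_creation (h : Implements V (rotation θ)) (hv : V vacuum = vacuum) (n : ℕ) :
    V (creation^[n] vacuum) =
      Complex.exp (-(Complex.I * (n : ℂ) * (θ : ℂ))) • creation^[n] vacuum := by
  induction n with
  | zero => simp [hv]
  | succ n ih =>
    rw [Function.iterate_succ_apply', h.map_creation, ih, map_smul, smul_smul, ← Complex.exp_add]
    congr 2
    push_cast
    ring

theorem map_numberState (h : Implements V (rotation θ)) (hv : V vacuum = vacuum) (n : ℕ) :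
    V (numberState n) = Complex.exp (-(Complex.I * (n : ℂ) * (θ : ℂ))) • numberState n := by
  rw [numberState, map_smul, h.map_iterate_creation hv, smul_comm]

end Implements

/-- By covariance `V vacuum` is annihilated by `a`, hence is `c • vacuum`; isometry gives `‖c‖ = 1`,
and dividing by `c` leaves an implementing operator. -/
theorem exists_implements_rotation_map_vacuum (θ : ℝ) :
    ∃ V, Implements V (rotation θ) ∧ V vacuum = vacuum := by
  obtain ⟨V, hV⟩ := exists_implements_rotation θ
  have h1 : annihilation (V vacuum) = 0 := by
    have := hV.map_annihilation vacuum
    rw [annihilation_vacuum, map_zero, eq_comm, smul_eq_zero] at this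
    exact this.resolve_left (Complex.exp_ne_zero _)
  obtain ⟨c, hc⟩ := eq_smul_vacuum_of_annihilation_eq_zero h1
  have hv0 : ‖incl vacuum‖ ≠ 0 := by
    rw [norm_ne_zero_iff, ← map_zero incl, incl_injective.ne_iff]
    intro h
    exact vacuum_ne_zero 0 (by rw [h, zero_apply])
  have hc1 : ‖c‖ = 1 := by
    have := hV.norm_map vacuum
    rw [hc, map_smul, norm_smul] at this
    exact mul_right_cancel₀ hv0 (by rw [this, one_mul])
  have hc0 : c ≠ 0 := by
    rintro rfl
    simp at hc1
  obtain ⟨W, hW, hWV⟩ := hV.smul ⟨c⁻¹, mem_sphere_zero_iff_norm.2 (by rw [norm_inv, hc1, inv_one])⟩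
  refine ⟨W, hW, ?_⟩
  rw [hWV, hc, smul_smul]
  simp [hc0]

/-! ## Quadrature kets -/

/-- The generalized ket `φ ↦ conj ((V φ)(q))`. -/
def quadratureKet (V : 𝓢(ℝ, ℂ) ≃L[ℂ] 𝓢(ℝ, ℂ)) (q : ℝ) : Ket where
  toFun φ := conj (V φ q)
  map_add' φ χ := by simp
  map_smul' c φ := by simp
  cont := by
    have h : Continuous fun f : 𝓢(ℝ, ℂ) => f q :=
      ((BoundedContinuousFunction.evalCLM ℂ q).comp
        (SchwartzMap.toBoundedContinuousFunctionCLM ℂ ℝ ℂ)).continuous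
    exact Complex.continuous_conj.comp (h.comp V.continuous)

theorem quadratureKet_apply (V : 𝓢(ℝ, ℂ) ≃L[ℂ] 𝓢(ℝ, ℂ)) (q : ℝ) (φ : 𝓢(ℝ, ℂ)) :
    quadratureKet V q φ = conj (V φ q) := rfl

theorem Implements.inner_map {V : 𝓢(ℝ, ℂ) ≃L[ℂ] 𝓢(ℝ, ℂ)} {A : ℝ × ℝ → ℝ × ℝ}
    (h : Implements V A) (φ χ : 𝓢(ℝ, ℂ)) :
    ⟪incl (V φ), incl (V χ)⟫_ℂ = ⟪incl φ, incl χ⟫_ℂ := by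
  rw [inner_eq_sum_norm_sq_div_four, inner_eq_sum_norm_sq_div_four]
  simp only [← map_smul, ← map_add, ← map_sub, h.norm_map]

theorem isCompleteFamily_quadratureKet {V : 𝓢(ℝ, ℂ) ≃L[ℂ] 𝓢(ℝ, ℂ)} {A : ℝ × ℝ → ℝ × ℝ}
    (h : Implements V A) : IsCompleteFamily (quadratureKet V) := by
  intro φ χ
  simp only [quadratureKet_apply, Complex.conj_conj]
  constructor
  · have h1 := ((V φ).memLp 2 volume).star.integrable_mul ((V χ).memLp 2 volume)
    exact h1
  · rw [← inner_incl, h.inner_map]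

/-! ## Extension to the Hilbert space -/

theorem displacement_incl (q p : ℝ) (f : 𝓢(ℝ, ℂ)) :
    displacement q p (incl f) = incl (schwartzDisplacement (q, p) f) := by
  refine Lp.ext ?_
  have h1 : ∀ᵐ x : ℝ, incl f (x - q) = f (x - q) :=
    (measurePreserving_sub_right (volume : Measure ℝ) q).quasiMeasurePreserving.ae (coeFn_incl f)
  filter_upwards [displacement_apply q p (incl f), coeFn_incl (schwartzDisplacement (q, p) f), h1]
    with x e1 e2 e3
  rw [e1, e2, e3, schwartzDisplacement_apply]

theorem parity_apply (ψ : Hilb) : ∀ᵐ x : ℝ, parity ψ x = ψ (-x) :=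
  Lp.coeFn_compMeasurePreserving ψ (Measure.measurePreserving_neg (volume : Measure ℝ))

theorem ae_neg {p : ℝ → Prop} (h : ∀ᵐ x : ℝ, p x) : ∀ᵐ x : ℝ, p (-x) :=
  (Measure.measurePreserving_neg (volume : Measure ℝ)).quasiMeasurePreserving.ae h

theorem parity_incl (f : 𝓢(ℝ, ℂ)) : parity (incl f) = incl (schwartzParity f) := by
  refine Lp.ext ?_
  filter_upwards [parity_apply (incl f), coeFn_incl (schwartzParity f), ae_neg (coeFn_incl f)]
    with x e1 e2 e3
  rw [e1, e2, e3, schwartzParity_apply]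

theorem inner_parity (ψ χ : Hilb) : ⟪parity ψ, χ⟫_ℂ = ⟪ψ, parity χ⟫_ℂ := by
  rw [L2.inner_def, L2.inner_def, ← integral_neg_eq_self]
  refine integral_congr_ae ?_
  filter_upwards [ae_neg (parity_apply ψ), parity_apply χ] with x e1 e2
  rw [e1, e2, neg_neg]

/-- The unitary extension to `L²(ℝ)` of an isometric automorphism of the Schwartz space. -/
def unitaryExtension {V : 𝓢(ℝ, ℂ) ≃L[ℂ] 𝓢(ℝ, ℂ)} {A : ℝ × ℝ → ℝ × ℝ} (h : Implements V A) :
    Hilb ≃ₗᵢ[ℂ] Hilb :=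
  V.toLinearEquiv.extendOfIsometry incl.toLinearMap incl.toLinearMap denseRange_incl
    denseRange_incl h.norm_map

namespace Implements

variable {V : 𝓢(ℝ, ℂ) ≃L[ℂ] 𝓢(ℝ, ℂ)} {A : ℝ × ℝ → ℝ × ℝ} (h : Implements V A)

theorem unitaryExtension_incl (f : 𝓢(ℝ, ℂ)) : unitaryExtension h (incl f) = incl (V f) :=
  LinearEquiv.extendOfIsometry_eq V.toLinearEquiv incl.toLinearMap incl.toLinearMap denseRange_incl
    denseRange_incl h.norm_map f

theorem unitaryExtension_symm_incl (f : 𝓢(ℝ, ℂ)) :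
    (unitaryExtension h).symm (incl f) = incl (V.symm f) := by
  rw [LinearIsometryEquiv.symm_apply_eq, unitaryExtension_incl, V.apply_symm_apply]

theorem unitaryExtension_displacement (q p : ℝ) (ψ : Hilb) :
    unitaryExtension h (displacement q p ψ) =
      displacement (A (q, p)).1 (A (q, p)).2 (unitaryExtension h ψ) := by
  refine denseRange_incl.induction_on (p := fun ψ => unitaryExtension h (displacement q p ψ) =
      displacement (A (q, p)).1 (A (q, p)).2 (unitaryExtension h ψ)) ψ
    (isClosed_eq (by fun_prop) (by fun_prop)) fun f => ?_
  rw [displacement_incl, unitaryExtension_incl, h.map_displacement, unitaryExtension_incl,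
    displacement_incl]

theorem unitaryExtension_parity (ψ : Hilb) :
    unitaryExtension h (parity ψ) = parity (unitaryExtension h ψ) := by
  refine denseRange_incl.induction_on (p := fun ψ => unitaryExtension h (parity ψ) =
      parity (unitaryExtension h ψ)) ψ
    (isClosed_eq (by fun_prop) (by fun_prop)) fun f => ?_
  rw [parity_incl, unitaryExtension_incl, h.map_parity, unitaryExtension_incl, parity_incl]

end Implements

/-! ## Multiplication operators -/

/-- Multiplication by an essentially bounded function. -/
def multiplication {g : ℝ → ℂ} (hg : MemLp g ∞ (volume : Measure ℝ)) : Hilb →L[ℂ] Hilb :=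
  (ContinuousLinearMap.mul ℂ ℂ).holderL (volume : Measure ℝ) ∞ 2 2 hg.toLp

theorem multiplication_apply {g : ℝ → ℂ} (hg : MemLp g ∞ (volume : Measure ℝ)) (ψ : Hilb) :
    ∀ᵐ x : ℝ, multiplication hg ψ x = g x * ψ x := by
  have h1 := (ContinuousLinearMap.mul ℂ ℂ).coeFn_holder (r := 2) hg.toLp ψ
  filter_upwards [h1, hg.coeFn_toLp] with x e1 e2
  refine Eq.trans e1 ?_
  simp [e2]

theorem multiplication_incl {g : ℝ → ℂ} (hg : MemLp g ∞ (volume : Measure ℝ))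
    (hg' : g.HasTemperateGrowth) (f : 𝓢(ℝ, ℂ)) :
    multiplication hg (incl f) = incl (SchwartzMap.smulLeftCLM ℂ g f) := by
  refine Lp.ext ?_
  filter_upwards [multiplication_apply hg (incl f), coeFn_incl f,
    coeFn_incl (SchwartzMap.smulLeftCLM ℂ g f)] with x e1 e2 e3
  rw [e1, e2, e3, SchwartzMap.smulLeftCLM_apply_apply hg', smul_eq_mul]

theorem displacement_zero_apply (s : ℝ) (ψ : Hilb) :
    ∀ᵐ x : ℝ, displacement 0 s ψ x = Complex.exp (Complex.I * ((s * x : ℝ) : ℂ)) * ψ x := by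
  filter_upwards [displacement_apply 0 s ψ] with x e
  simpa [weylPhase] using e

theorem inner_displacement_zero (s : ℝ) (ψ χ : Hilb) :
    ⟪displacement 0 (-s) ψ, χ⟫_ℂ = ⟪ψ, displacement 0 s χ⟫_ℂ := by
  rw [L2.inner_def, L2.inner_def]
  refine integral_congr_ae ?_
  filter_upwards [displacement_zero_apply (-s) ψ, displacement_zero_apply s χ] with x e1 e2
  rw [e1, e2, RCLike.inner_apply, RCLike.inner_apply, map_mul, ← Complex.exp_conj, map_mul,
    Complex.conj_I, Complex.conj_ofReal]
  push_cast
  ring_nf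

/-- Parity reverses the sign of `s`, so the two phases add up instead of cancelling. This doubling
is why a segment of length `L` yields `sin (x L)` and not `sin (x L / 2)`. -/
theorem displacement_parity_displacement (s : ℝ) (ψ : Hilb) :
    displacement 0 s (parity (displacement 0 (-s) ψ)) = displacement 0 (2 * s) (parity ψ) := by
  refine Lp.ext ?_
  filter_upwards [displacement_zero_apply s (parity (displacement 0 (-s) ψ)),
    parity_apply (displacement 0 (-s) ψ), ae_neg (displacement_zero_apply (-s) ψ),
    displacement_zero_apply (2 * s) (parity ψ), parity_apply ψ] with x e1 e2 e3 e4 e5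
  rw [e1, e2, e3, e4, e5, ← mul_assoc, ← Complex.exp_add]
  congr 2
  push_cast
  ring

theorem Implements.pointOperator_apply {V : 𝓢(ℝ, ℂ) ≃L[ℂ] 𝓢(ℝ, ℂ)} {θ : ℝ}
    (h : Implements V (rotation θ)) (s : ℝ) (ψ : Hilb) :
    pointOperator (s * -Real.sin θ) (s * Real.cos θ) ψ =
      (unitaryExtension h).symm
        (displacement 0 (2 * s) (unitaryExtension h (parity ψ))) := by
  set U := unitaryExtension h with hU
  have hA : rotation θ (s * -Real.sin θ, s * Real.cos θ) = (0, s) := by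
    simp only [rotation, Prod.mk.injEq]
    constructor
    · ring
    · linear_combination s * Real.sin_sq_add_cos_sq θ
  have hD : ∀ χ, displacement (s * -Real.sin θ) (s * Real.cos θ) χ =
      U.symm (displacement 0 s (U χ)) := fun χ => by
    rw [LinearIsometryEquiv.eq_symm_apply, hU, h.unitaryExtension_displacement, hA]
  have hadj : ∀ χ, ContinuousLinearMap.adjoint
      (displacement (s * -Real.sin θ) (s * Real.cos θ)) χ =
      U.symm (displacement 0 (-s) (U χ)) := fun χ => by
    refine ext_inner_right ℂ fun ξ => ?_
    rw [ContinuousLinearMap.adjoint_inner_left, hD, ← U.inner_map_map χ,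
      ← U.inner_map_map (U.symm _) ξ, U.apply_symm_apply, U.apply_symm_apply,
      inner_displacement_zero]
  rw [pointOperator, ContinuousLinearMap.comp_apply, ContinuousLinearMap.comp_apply, hadj, hD,
    hU, h.unitaryExtension_parity, h.unitaryExtension_parity, LinearIsometryEquiv.apply_symm_apply,
    displacement_parity_displacement]

/-! ## The function `sin (x L) / x` -/

theorem sinOver_neg (L x : ℝ) : sinOver L (-x) = sinOver L x := by
  by_cases h : x = 0
  · simp [h]
  · simp [sinOver, h]

theorem integral_exp_eq_sinOver (L x : ℝ) :
    ∫ s in (-L / 2)..(L / 2), Complex.exp (Complex.I * ((2 * s * x : ℝ) : ℂ)) =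
      (sinOver L x : ℂ) := by
  by_cases h : x = 0
  · simp [h, sinOver]
    ring
  · have hx : (x : ℂ) ≠ 0 := by exact_mod_cast h
    have hc : 2 * Complex.I * (x : ℂ) ≠ 0 := by simp [h]
    have h1 := integral_exp_mul_complex (a := -L / 2) (b := L / 2) hc
    have h2 : ∀ s : ℝ, Complex.exp (Complex.I * ((2 * s * x : ℝ) : ℂ)) =
        Complex.exp (2 * Complex.I * (x : ℂ) * s) := fun s => by
      congr 1
      push_cast
      ring
    simp only [h2]
    rw [h1, sinOver, if_neg h, Complex.ofReal_div (Real.sin _), Complex.ofReal_sin, Complex.sin]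
    rw [show 2 * Complex.I * (x : ℂ) * ((L / 2 : ℝ) : ℂ) = ((x * L : ℝ) : ℂ) * Complex.I by
        push_cast; ring,
      show 2 * Complex.I * (x : ℂ) * ((-L / 2 : ℝ) : ℂ) = -((x * L : ℝ) : ℂ) * Complex.I by
        push_cast; ring]
    field_simp
    rw [Complex.I_sq]
    ring

theorem norm_sinOver_le {L : ℝ} (hL : 0 < L) (x : ℝ) : ‖(sinOver L x : ℂ)‖ ≤ L := by
  rw [← integral_exp_eq_sinOver]
  refine (intervalIntegral.norm_integral_le_of_norm_le_const (C := 1) fun s _ => ?_).trans ?_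
  · rw [mul_comm, Complex.norm_exp_ofReal_mul_I]
  · rw [show L / 2 - -L / 2 = L by ring, abs_of_pos hL, one_mul]

/-- The function is the Fourier transform of a box. All moments of the box are integrable, so every
derivative is bounded and the point `x = 0` needs no separate treatment. -/
theorem hasTemperateGrowth_sinOver {L : ℝ} (hL : 0 < L) :
    (fun x : ℝ => (sinOver L x : ℂ)).HasTemperateGrowth := by
  have hpi := Real.pi_pos
  -- Half-width `L / (2 π)` and height `π` come from the substitution `s = -π v`.
  set w : ℝ → ℂ := Set.indicator (Set.Ioc (-(L / 2) / Real.pi) ((L / 2) / Real.pi))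
    (fun _ => (Real.pi : ℂ)) with hw
  have hle : -(L / 2) / Real.pi ≤ (L / 2) / Real.pi := by gcongr; linarith
  have hF : (fun x : ℝ => (sinOver L x : ℂ)) = 𝓕 w := by
    ext x
    rw [Real.fourier_real_eq_integral_exp_smul, ← integral_exp_eq_sinOver]
    have h1 : (fun v : ℝ => Complex.exp (((-2 * Real.pi * v * x : ℝ) : ℂ) * Complex.I) • w v) =
        Set.indicator (Set.Ioc (-(L / 2) / Real.pi) ((L / 2) / Real.pi)) (fun v : ℝ =>
          Complex.exp (((-2 * Real.pi * v * x : ℝ) : ℂ) * Complex.I) * (Real.pi : ℂ)) := by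
      ext v
      by_cases hv : v ∈ Set.Ioc (-(L / 2) / Real.pi) ((L / 2) / Real.pi) <;> simp [hw, hv]
    rw [h1, integral_indicator measurableSet_Ioc, ← intervalIntegral.integral_of_le hle]
    have h2 := intervalIntegral.smul_integral_comp_mul_left
      (f := fun s : ℝ => Complex.exp (Complex.I * ((2 * s * x : ℝ) : ℂ))) (a := (L / 2) / Real.pi)
      (b := -(L / 2) / Real.pi) (-Real.pi)
    rw [show -Real.pi * ((L / 2) / Real.pi) = -L / 2 by field_simp,
      show -Real.pi * (-(L / 2) / Real.pi) = L / 2 by field_simp] at h2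
    rw [← h2, intervalIntegral.integral_symm, smul_neg, neg_smul, neg_neg,
      ← intervalIntegral.integral_smul]
    congr 1
    ext v
    rw [Complex.real_smul, mul_comm]
    congr 2
    push_cast
    ring
  have hint : ∀ n : ℕ, Integrable (fun v : ℝ => v ^ n • w v) := by
    intro n
    have h1 : (fun v : ℝ => v ^ n • w v) =
        Set.indicator (Set.Ioc (-(L / 2) / Real.pi) ((L / 2) / Real.pi))
          (fun v : ℝ => v ^ n • (Real.pi : ℂ)) := by
      ext v
      by_cases hv : v ∈ Set.Ioc (-(L / 2) / Real.pi) ((L / 2) / Real.pi) <;> simp [hw, hv]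
    rw [h1, integrable_indicator_iff measurableSet_Ioc]
    have hc : Continuous (fun v : ℝ => v ^ n • (Real.pi : ℂ)) := by fun_prop
    exact (hc.integrableOn_Icc).mono_set Set.Ioc_subset_Icc_self
  rw [hF]
  refine hasTemperateGrowth_of_iteratedDeriv_bounded ?_ fun n => ?_
  · refine Real.contDiff_fourier fun n _ => ?_
    refine (hint n).norm.congr (Filter.Eventually.of_forall fun v => ?_)
    simp
  · rw [Real.iteratedDeriv_fourier (N := ⊤) (fun n _ => hint n) le_top]
    refine ⟨∫ v : ℝ, ‖(-2 * Real.pi * Complex.I * (v : ℂ)) ^ n • w v‖, fun x => ?_⟩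
    rw [Real.fourier_real_eq_integral_exp_smul]
    refine (norm_integral_le_integral_norm _).trans (le_of_eq ?_)
    simp only [norm_smul, Complex.norm_exp_ofReal_mul_I, one_mul]

theorem memLp_sinOver {L : ℝ} (hL : 0 < L) :
    MemLp (fun x : ℝ => (sinOver L x : ℂ)) ∞ (volume : Measure ℝ) :=
  memLp_top_of_bound
    (hasTemperateGrowth_sinOver hL).1.continuous.aestronglyMeasurable L
    (Filter.Eventually.of_forall fun x => norm_sinOver_le hL x)

/-! ## The segment operator as an integral of displacements -/

theorem norm_displacement_zero (s : ℝ) (ψ : Hilb) : ‖displacement 0 s ψ‖ = ‖ψ‖ := by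
  rw [Lp.norm_def, Lp.norm_def]
  congr 1
  refine eLpNorm_congr_norm_ae ?_
  filter_upwards [displacement_zero_apply s ψ] with x e
  rw [e, norm_mul, mul_comm Complex.I, Complex.norm_exp_ofReal_mul_I, one_mul]

theorem norm_displacement_zero_sub_le (s t : ℝ) (f : 𝓢(ℝ, ℂ)) :
    ‖displacement 0 s (incl f) - displacement 0 t (incl f)‖ ≤ |s - t| * ‖incl (position f)‖ := by
  refine Lp.norm_le_mul_norm_of_ae_le_mul ?_
  filter_upwards [displacement_zero_apply s (incl f), displacement_zero_apply t (incl f),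
    Lp.coeFn_sub (displacement 0 s (incl f)) (displacement 0 t (incl f)), coeFn_incl f,
    coeFn_incl (position f)] with x e1 e2 e3 e4 e5
  rw [e3, Pi.sub_apply, e1, e2, e4, e5, position_apply, ← sub_mul]
  have h1 : Complex.exp (Complex.I * ((s * x : ℝ) : ℂ)) -
      Complex.exp (Complex.I * ((t * x : ℝ) : ℂ)) =
      Complex.exp (((t * x : ℝ) : ℂ) * Complex.I) *
        (Complex.exp (Complex.I * (((s - t) * x : ℝ) : ℂ)) - 1) := by
    rw [mul_sub, ← Complex.exp_add, mul_one]
    congr 2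
    · push_cast; ring
    · ring
  rw [h1, norm_mul, norm_mul, norm_mul, Complex.norm_exp_ofReal_mul_I, one_mul, ← mul_assoc]
  refine mul_le_mul_of_nonneg_right ((Real.norm_exp_I_mul_ofReal_sub_one_le).trans ?_)
    (norm_nonneg _)
  rw [norm_mul, Complex.norm_real, Real.norm_eq_abs, Real.norm_eq_abs]

/-- On Schwartz functions the map is Lipschitz with constant `‖Q f‖`; since displacements are
isometries, the approximation by these is uniform in `s`. -/
theorem continuous_displacement_zero (ψ : Hilb) : Continuous fun s => displacement 0 s ψ := by
  refine continuous_of_uniform_approx_of_continuous fun u hu => ?_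
  obtain ⟨ε, hε, hu⟩ := Metric.mem_uniformity_dist.1 hu
  obtain ⟨f, hf⟩ := denseRange_incl.exists_dist_lt ψ hε
  refine ⟨fun s => displacement 0 s (incl f), ?_, fun s => hu ?_⟩
  · refine (LipschitzWith.of_dist_le_mul (K := ‖incl (position f)‖₊) fun s t => ?_).continuous
    rw [dist_eq_norm, mul_comm, Real.dist_eq]
    exact norm_displacement_zero_sub_le s t f
  · rw [dist_eq_norm, ← map_sub, norm_displacement_zero, ← dist_eq_norm]
    exact hf

/-- Tested against an arbitrary `χ`, the identity is Fubini's theorem, the integrand being dominated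
by the integrable function `⟪χ x, ψ x⟫` on a bounded `s`-interval. -/
theorem integral_displacement_zero {L : ℝ} (hL : 0 < L) (ψ : Hilb) :
    ∫ s in (-L / 2)..(L / 2), displacement 0 (2 * s) ψ = multiplication (memLp_sinOver hL) ψ := by
  have hcont : Continuous fun s : ℝ => displacement 0 (2 * s) ψ :=
    (continuous_displacement_zero ψ).comp (continuous_const_mul 2)
  have hle : -L / 2 ≤ L / 2 := by linarith
  refine ext_inner_left ℂ fun χ => ?_
  have h1 := ContinuousLinearMap.intervalIntegral_comp_comm (innerSL ℂ χ)
    (hcont.intervalIntegrable (μ := volume) (-L / 2) (L / 2))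
  simp only [innerSL_apply_apply] at h1
  rw [← h1]
  have h2 : ∀ s : ℝ, ⟪χ, displacement 0 (2 * s) ψ⟫_ℂ =
      ∫ x, Complex.exp (Complex.I * ((2 * s * x : ℝ) : ℂ)) * ⟪χ x, ψ x⟫_ℂ := fun s => by
    rw [L2.inner_def]
    refine integral_congr_ae ?_
    filter_upwards [displacement_zero_apply (2 * s) ψ] with x e
    rw [e, RCLike.inner_apply, RCLike.inner_apply, mul_assoc]
  have h3 : ⟪χ, multiplication (memLp_sinOver hL) ψ⟫_ℂ =
      ∫ x, (sinOver L x : ℂ) * ⟪χ x, ψ x⟫_ℂ := by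
    rw [L2.inner_def]
    refine integral_congr_ae ?_
    filter_upwards [multiplication_apply (memLp_sinOver hL) ψ] with x e
    rw [e, RCLike.inner_apply, RCLike.inner_apply, mul_assoc]
  simp only [h2]
  rw [h3, intervalIntegral.integral_of_le hle, integral_integral_swap]
  · refine integral_congr_ae (Filter.Eventually.of_forall fun x => ?_)
    simp only [integral_mul_const]
    rw [← intervalIntegral.integral_of_le hle, integral_exp_eq_sinOver]
  · have hi : Integrable (fun x => ⟪χ x, ψ x⟫_ℂ) := L2.integrable_inner χ ψ
    have hp := hi.comp_snd (volume.restrict (Set.Ioc (-L / 2) (L / 2)))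
    refine hp.bdd_mul (c := 1) (Continuous.aestronglyMeasurable (by fun_prop))
      (Filter.Eventually.of_forall fun z => ?_)
    rw [mul_comm, Complex.norm_exp_ofReal_mul_I]

/-! ## Quadratures as multiplication operators -/

/-- The function `x ↦ 1 / (x + i)`. -/
def resolventFun (x : ℝ) : ℂ := ((x : ℂ) + Complex.I)⁻¹

theorem ofReal_add_I_ne_zero (x : ℝ) : (x : ℂ) + Complex.I ≠ 0 := by
  intro h
  have := congrArg Complex.im h
  simp at this

theorem hasTemperateGrowth_resolventFun : resolventFun.HasTemperateGrowth := by
  have h1 : (fun x : ℝ =>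
      ((x : ℂ) - Complex.I) * (((1 + ‖x‖ ^ 2) ^ (-1 : ℝ) : ℝ) : ℂ)).HasTemperateGrowth := by
    have h2 : (fun x : ℝ => (x : ℂ)).HasTemperateGrowth := Complex.ofRealCLM.hasTemperateGrowth
    have h3 := h2.comp (Function.hasTemperateGrowth_one_add_norm_sq_rpow ℝ (-1))
    exact (h2.sub (.const Complex.I)).mul h3
  convert h1 using 1
  ext x
  have h2 := ofReal_add_I_ne_zero x
  have h3 : (1 + (x : ℂ) ^ 2) ≠ 0 := by
    have : (1 + x ^ 2 : ℝ) ≠ 0 := by positivity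
    exact_mod_cast this
  rw [resolventFun, Real.rpow_neg_one, Real.norm_eq_abs, sq_abs]
  push_cast
  field_simp
  linear_combination Complex.I_sq

theorem norm_ofReal_add_I (x : ℝ) : ‖(x : ℂ) + Complex.I‖ = √(x ^ 2 + 1) := by
  simpa using Complex.norm_add_mul_I x 1

theorem memLp_resolventFun : MemLp resolventFun ∞ (volume : Measure ℝ) := by
  refine memLp_top_of_bound hasTemperateGrowth_resolventFun.1.continuous.aestronglyMeasurable 1
    (Filter.Eventually.of_forall fun x => ?_)
  rw [resolventFun, norm_inv, norm_ofReal_add_I]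
  refine inv_le_one_of_one_le₀ (Real.one_le_sqrt.2 ?_)
  nlinarith [sq_nonneg x]

theorem memLp_mul_resolventFun :
    MemLp (fun x : ℝ => (x : ℂ) * resolventFun x) ∞ (volume : Measure ℝ) := by
  have hc : Continuous fun x : ℝ => (x : ℂ) * resolventFun x :=
    Complex.continuous_ofReal.mul hasTemperateGrowth_resolventFun.1.continuous
  refine memLp_top_of_bound hc.aestronglyMeasurable 1
    (Filter.Eventually.of_forall fun x => ?_)
  rw [resolventFun, norm_mul, norm_inv, norm_ofReal_add_I, Complex.norm_real, Real.norm_eq_abs,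
    ← div_eq_mul_inv]
  refine div_le_one_of_le₀ (Real.abs_le_sqrt (by linarith)) (Real.sqrt_nonneg _)

theorem mem_graph_onSchwartz {A : 𝓢(ℝ, ℂ) →L[ℂ] 𝓢(ℝ, ℂ)} {p : Hilb × Hilb} :
    p ∈ (onSchwartz A).graph ↔ ∃ f, p = (incl f, incl (A f)) := by
  have key : ∀ f (hf : incl f ∈ (onSchwartz A).domain), onSchwartz A ⟨incl f, hf⟩ = incl (A f) := by
    intro f hf
    change incl (A ((LinearEquiv.ofInjective incl.toLinearMap incl_injective).symm
      ⟨incl f, hf⟩)) = _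
    congr 2
    rw [LinearEquiv.symm_apply_eq]
    rfl
  rw [LinearPMap.mem_graph_iff]
  constructor
  · rintro ⟨⟨_, f, rfl⟩, h1, h2⟩
    exact ⟨f, Prod.ext h1.symm (h2.symm.trans (key f _))⟩
  · rintro ⟨f, rfl⟩
    exact ⟨⟨incl f, f, rfl⟩, rfl, key f _⟩

namespace Implements

variable {V : 𝓢(ℝ, ℂ) ≃L[ℂ] 𝓢(ℝ, ℂ)} {θ : ℝ} (h : Implements V (rotation θ))

/-- With `r = 1 / (x + i)`, both `r` and `x r` are bounded, so `r · U p.2 = x r · U p.1` is a closed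
condition that holds on the core. Conversely, every pair on the graph of multiplication by `x` has
the form `(r χ, x r χ)` with `χ` in `L²`. For Schwartz `χ` it comes from the core, because `r`
preserves the Schwartz space, and density does the rest. -/
theorem mem_closure_graph_iff {p : Hilb × Hilb} :
    p ∈ (onSchwartz (quadratureCore θ)).graph.topologicalClosure ↔
      ∀ᵐ x : ℝ, unitaryExtension h p.2 x = (x : ℂ) * unitaryExtension h p.1 x := by
  set U := unitaryExtension h with hU
  constructor
  · intro hp
    have hcl : IsClosed {p : Hilb × Hilb | multiplication memLp_resolventFun (U p.2) =
        multiplication memLp_mul_resolventFun (U p.1)} :=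
      isClosed_eq (by fun_prop) (by fun_prop)
    have hsub : ((onSchwartz (quadratureCore θ)).graph : Set (Hilb × Hilb)) ⊆
        {p : Hilb × Hilb | multiplication memLp_resolventFun (U p.2) =
        multiplication memLp_mul_resolventFun (U p.1)} := by
      intro p hp
      obtain ⟨f, rfl⟩ := mem_graph_onSchwartz.1 hp
      rw [Set.mem_ofPred_eq, hU, h.unitaryExtension_incl, h.unitaryExtension_incl,
        h.map_quadratureCore]
      refine Lp.ext ?_
      filter_upwards [multiplication_apply memLp_resolventFun (incl (position (V f))),
        multiplication_apply memLp_mul_resolventFun (incl (V f)), coeFn_incl (V f),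
        coeFn_incl (position (V f))] with x e1 e2 e3 e4
      rw [e1, e2, e3, e4, position_apply]
      ring
    have hp' := closure_minimal hsub hcl hp
    rw [Set.mem_ofPred_eq] at hp'
    filter_upwards [multiplication_apply memLp_resolventFun (U p.2),
      multiplication_apply memLp_mul_resolventFun (U p.1)] with x e1 e2
    rw [hp', e2] at e1
    have : resolventFun x ≠ 0 := inv_ne_zero (ofReal_add_I_ne_zero x)
    refine mul_left_cancel₀ this ?_
    rw [← e1]
    ring
  · intro hp
    -- This is `(x + i) U p.1`, written so that membership in `L²` is evident.
    set χ : Hilb := U p.2 + Complex.I • U p.1 with hχ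
    have hχx : ∀ᵐ x : ℝ, χ x = ((x : ℂ) + Complex.I) * U p.1 x := by
      filter_upwards [hp, Lp.coeFn_add (U p.2) (Complex.I • U p.1),
        Lp.coeFn_smul Complex.I (U p.1)] with x e1 e2 e3
      rw [e2, Pi.add_apply, e3, e1, Pi.smul_apply, smul_eq_mul]
      ring
    have hp1 : U.symm (multiplication memLp_resolventFun χ) = p.1 := by
      rw [LinearIsometryEquiv.symm_apply_eq]
      refine Lp.ext ?_
      filter_upwards [hχx, multiplication_apply memLp_resolventFun χ] with x e1 e2
      rw [e2, e1, resolventFun, inv_mul_cancel_left₀ (ofReal_add_I_ne_zero x)]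
    have hp2 : U.symm (multiplication memLp_mul_resolventFun χ) = p.2 := by
      rw [LinearIsometryEquiv.symm_apply_eq]
      refine Lp.ext ?_
      filter_upwards [hχx, multiplication_apply memLp_mul_resolventFun χ, hp] with x e1 e2 e3
      rw [e2, e1, e3, resolventFun, mul_assoc, inv_mul_cancel_left₀ (ofReal_add_I_ne_zero x)]
    have key : ∀ χ : Hilb, (U.symm (multiplication memLp_resolventFun χ),
        U.symm (multiplication memLp_mul_resolventFun χ)) ∈
        (onSchwartz (quadratureCore θ)).graph.topologicalClosure := by
      intro χ
      refine denseRange_incl.induction_on (p := fun χ =>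
        (U.symm (multiplication memLp_resolventFun χ),
        U.symm (multiplication memLp_mul_resolventFun χ)) ∈
        (onSchwartz (quadratureCore θ)).graph.topologicalClosure) χ ?_ fun g => ?_
      · exact (Submodule.isClosed_topologicalClosure _).preimage (by fun_prop)
      · refine Submodule.le_topologicalClosure _ (mem_graph_onSchwartz.2
          ⟨V.symm (SchwartzMap.smulLeftCLM ℂ resolventFun g), Prod.ext ?_ ?_⟩)
        · rw [multiplication_incl _ hasTemperateGrowth_resolventFun, hU,
            h.unitaryExtension_symm_incl]
        · have hx : (fun x : ℝ => (x : ℂ) * resolventFun x).HasTemperateGrowth :=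
            Function.HasTemperateGrowth.mul Complex.ofRealCLM.hasTemperateGrowth
              hasTemperateGrowth_resolventFun
          change U.symm _ = incl _
          rw [LinearIsometryEquiv.symm_apply_eq, hU, h.unitaryExtension_incl,
            h.map_quadratureCore, V.apply_symm_apply, multiplication_incl _ hx]
          congr 1
          ext x
          rw [position_apply, SchwartzMap.smulLeftCLM_apply_apply hx,
            SchwartzMap.smulLeftCLM_apply_apply hasTemperateGrowth_resolventFun, smul_eq_mul,
            smul_eq_mul, mul_assoc]
    have := key χ
    rwa [hp1, hp2] at this

/-- Closability must be checked, since the closure of a non-closable operator is a default value: in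
the closed relation, first component `0` forces second component `0`. -/
theorem graph_quadrature (h : Implements V (rotation θ)) :
    (quadrature θ).graph = (onSchwartz (quadratureCore θ)).graph.topologicalClosure := by
  have hcl : (onSchwartz (quadratureCore θ)).IsClosable := by
    refine ⟨(onSchwartz (quadratureCore θ)).graph.topologicalClosure.toLinearPMap, ?_⟩
    rw [Submodule.toLinearPMap_graph_eq]
    intro p hp hp1
    have h1 := (mem_closure_graph_iff h).1 hp
    rw [hp1, map_zero] at h1
    rw [← map_eq_zero_iff _ (unitaryExtension h).injective, Lp.eq_zero_iff_ae_eq_zero]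
    filter_upwards [h1, Lp.coeFn_zero ℂ 2 (volume : Measure ℝ)] with x e1 e2
    rw [e1, e2]
    simp
  exact hcl.graph_closure_eq_closure_graph.symm

/-- The operator `f_L(Q_θ)`. -/
def sinOperator {L : ℝ} (hL : 0 < L) : Hilb →L[ℂ] Hilb :=
  (unitaryExtension h).symm.toContinuousLinearEquiv.toContinuousLinearMap ∘L
    multiplication (memLp_sinOver hL) ∘L
      (unitaryExtension h).toContinuousLinearEquiv.toContinuousLinearMap

theorem sinOperator_apply {L : ℝ} (hL : 0 < L) (ψ : Hilb) :
    sinOperator h hL ψ = (unitaryExtension h).symm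
      (multiplication (memLp_sinOver hL) (unitaryExtension h ψ)) := rfl

theorem isFunctionOf_sinOperator {L : ℝ} (hL : 0 < L) :
    IsFunctionOf (quadrature θ) (fun x : ℝ => (sinOver L x : ℂ)) (sinOperator h hL) := by
  refine ⟨ℝ, inferInstance, volume, unitaryExtension h, id, measurable_id, ?_, ?_, ?_⟩
  · intro ψ
    rw [LinearPMap.mem_domain_iff]
    constructor
    · rintro ⟨η, hη⟩
      rw [graph_quadrature h, mem_closure_graph_iff h] at hη
      exact (memLp_congr_ae hη).1 (Lp.memLp _)
    · intro hψ
      refine ⟨(unitaryExtension h).symm hψ.toLp, ?_⟩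
      rw [graph_quadrature h, mem_closure_graph_iff h, LinearIsometryEquiv.apply_symm_apply]
      exact hψ.coeFn_toLp
  · intro ψ
    have h1 := LinearPMap.mem_graph (quadrature θ) ψ
    rw [graph_quadrature h, mem_closure_graph_iff h] at h1
    exact h1
  · intro ψ
    rw [sinOperator_apply, LinearIsometryEquiv.apply_symm_apply]
    exact multiplication_apply _ _

theorem isSegmentOperator_sinOperator {L : ℝ} (hL : 0 < L) :
    IsSegmentOperator (-Real.sin θ, Real.cos θ) L (sinOperator h hL ∘L parity) := by
  intro ψ
  simp only [h.pointOperator_apply]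
  have hcont : Continuous fun s : ℝ => displacement 0 (2 * s) (unitaryExtension h (parity ψ)) :=
    (continuous_displacement_zero _).comp (continuous_const_mul 2)
  refine ⟨((unitaryExtension h).symm.continuous.comp hcont).intervalIntegrable _ _, ?_⟩
  rw [ContinuousLinearMap.comp_apply, sinOperator_apply, ← integral_displacement_zero hL]
  exact (ContinuousLinearMap.intervalIntegral_comp_comm
    (unitaryExtension h).symm.toContinuousLinearEquiv.toContinuousLinearMap
    (hcont.intervalIntegrable (μ := volume) _ _)).symm

/-- The adjoint of `f_L(Q_θ) Π` is `Π f_L(Q_θ)`. In the `V`-picture it acts on Schwartz functions by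
a tempered multiplier followed by parity, and evenness lets the multiplier come out unreflected. -/
theorem exists_incl_eq_adjoint {L : ℝ} (hL : 0 < L) (φ : 𝓢(ℝ, ℂ)) :
    ∃ η : 𝓢(ℝ, ℂ),
      incl η = ContinuousLinearMap.adjoint (sinOperator h hL ∘L parity) (incl φ) ∧
      ∀ x, V η x = (sinOver L x : ℂ) * V φ (-x) := by
  refine ⟨V.symm (schwartzParity
    (SchwartzMap.smulLeftCLM ℂ (fun x : ℝ => (sinOver L x : ℂ)) (V φ))), ?_, fun x => ?_⟩
  · refine ext_inner_right ℂ fun ψ => ?_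
    set U := unitaryExtension h with hU
    have hsym : ∀ χ ξ : Hilb, ⟪multiplication (memLp_sinOver hL) χ, ξ⟫_ℂ =
        ⟪χ, multiplication (memLp_sinOver hL) ξ⟫_ℂ := fun χ ξ => by
      rw [L2.inner_def, L2.inner_def]
      refine integral_congr_ae ?_
      filter_upwards [multiplication_apply (memLp_sinOver hL) χ,
        multiplication_apply (memLp_sinOver hL) ξ] with x e1 e2
      rw [e1, e2, RCLike.inner_apply, RCLike.inner_apply, map_mul, Complex.conj_ofReal]
      ring
    rw [ContinuousLinearMap.adjoint_inner_left, ContinuousLinearMap.comp_apply, sinOperator_apply,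
      ← U.inner_map_map (incl φ), LinearIsometryEquiv.apply_symm_apply, h.unitaryExtension_parity,
      ← hsym, ← inner_parity, ← U.inner_map_map _ ψ, hU, h.unitaryExtension_incl,
      h.unitaryExtension_incl, V.apply_symm_apply,
      multiplication_incl _ (hasTemperateGrowth_sinOver hL), parity_incl]
  · rw [V.apply_symm_apply, schwartzParity_apply,
      SchwartzMap.smulLeftCLM_apply_apply (hasTemperateGrowth_sinOver hL), sinOver_neg, smul_eq_mul]

theorem isGeneralizedEigenvector_add {L : ℝ} (hL : 0 < L) (q : ℝ) :
    IsGeneralizedEigenvector (sinOperator h hL ∘L parity) (sinOver L q : ℂ)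
      (quadratureKet V q + quadratureKet V (-q)) := by
  constructor
  · intro h0
    -- The even test vector gives the nonzero value `2 vacuum q`.
    have h1 := congrArg (fun F : Ket => F (V.symm vacuum)) h0
    have h2 : vacuum (-q) = vacuum q := by simp [vacuum_apply]
    simp only [add_apply, quadratureKet_apply, V.apply_symm_apply, zero_apply, h2, ← two_mul,
      mul_eq_zero, two_ne_zero, false_or, map_eq_zero] at h1
    exact vacuum_ne_zero q h1
  · intro φ
    obtain ⟨η, hη, hη'⟩ := exists_incl_eq_adjoint h hL φ
    refine ⟨η, hη, ?_⟩
    simp only [smul_apply, add_apply, quadratureKet_apply, hη', map_mul, Complex.conj_ofReal,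
      sinOver_neg, neg_neg, smul_eq_mul]
    ring

theorem isGeneralizedEigenvector_sub {L : ℝ} (hL : 0 < L) {q : ℝ} (hq : q ≠ 0) :
    IsGeneralizedEigenvector (sinOperator h hL ∘L parity) (-(sinOver L q : ℂ))
      (quadratureKet V q - quadratureKet V (-q)) := by
  constructor
  · intro h0
    -- The odd test vector gives `2 q vacuum q`, nonzero exactly when `q ≠ 0`.
    have h1 := congrArg (fun F : Ket => F (V.symm (position vacuum))) h0
    have h2 : vacuum (-q) = vacuum q := by simp [vacuum_apply]
    simp only [sub_apply, quadratureKet_apply, V.apply_symm_apply, zero_apply, position_apply, h2,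
      ← map_sub, map_eq_zero, ← sub_mul, mul_eq_zero, vacuum_ne_zero, or_false] at h1
    push_cast at h1
    refine hq (Complex.ofReal_eq_zero.1 ?_)
    linear_combination h1 / 2
  · intro φ
    obtain ⟨η, hη, hη'⟩ := exists_incl_eq_adjoint h hL φ
    refine ⟨η, hη, ?_⟩
    simp only [smul_apply, sub_apply, quadratureKet_apply, hη', map_mul, Complex.conj_ofReal,
      sinOver_neg, neg_neg, smul_eq_mul]
    ring

end Implements

end PhaseSpace

end

/-! ### Quadrature kets and the spectral form of the segment operator -/

theorem mainTheorem2 (θ : ℝ) :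
    ∃ ket : ℝ → PhaseSpace.Ket,
      (∀ (q : ℝ) (n : ℕ),
        conj (ket q (PhaseSpace.numberState n)) = PhaseSpace.hermiteCoeff θ q n) ∧
      (∀ (q : ℝ) (F : PhaseSpace.Ket),
        (∀ n : ℕ, conj (F (PhaseSpace.numberState n)) = PhaseSpace.hermiteCoeff θ q n) →
          F = ket q) ∧
      PhaseSpace.IsCompleteFamily ket ∧
      (∀ (q : ℝ) (φ : 𝓢(ℝ, ℂ)),
        ket q (PhaseSpace.quadratureCore θ φ) = (q : ℂ) * ket q φ) ∧
      ∀ L : ℝ, 0 < L →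
        ∃ K S : PhaseSpace.Hilb →L[ℂ] PhaseSpace.Hilb,
          PhaseSpace.IsSegmentOperator (-Real.sin θ, Real.cos θ) L K ∧
          PhaseSpace.IsFunctionOf (PhaseSpace.quadrature θ)
            (fun x : ℝ => (PhaseSpace.sinOver L x : ℂ)) S ∧
          K = S ∘L PhaseSpace.parity ∧
          (∀ q : ℝ, PhaseSpace.IsGeneralizedEigenvector K
            (PhaseSpace.sinOver L q : ℂ) (ket q + ket (-q))) ∧
          (∀ q : ℝ, q ≠ 0 → PhaseSpace.IsGeneralizedEigenvector K
            (-(PhaseSpace.sinOver L q : ℂ)) (ket q - ket (-q))) := by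
  obtain ⟨V, h, hv⟩ := PhaseSpace.exists_implements_rotation_map_vacuum θ
  have hn : ∀ (q : ℝ) (n : ℕ), conj (PhaseSpace.quadratureKet V q (PhaseSpace.numberState n)) =
      PhaseSpace.hermiteCoeff θ q n := by
    intro q n
    rw [PhaseSpace.quadratureKet_apply, Complex.conj_conj, h.map_numberState hv, smul_apply,
      smul_eq_mul, mul_comm, PhaseSpace.numberState_mul_exp_eq_hermiteCoeff]
  refine ⟨PhaseSpace.quadratureKet V, hn, ?_, PhaseSpace.isCompleteFamily_quadratureKet h, ?_, ?_⟩
  · intro q F hF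
    rw [← sub_eq_zero]
    refine PhaseSpace.ket_eq_zero fun n => ?_
    rw [sub_apply, sub_eq_zero]
    exact star_injective ((hF n).trans (hn q n).symm)
  · intro q φ
    rw [PhaseSpace.quadratureKet_apply, PhaseSpace.quadratureKet_apply, h.map_quadratureCore,
      PhaseSpace.position_apply, map_mul, Complex.conj_ofReal]
  · intro L hL
    exact ⟨_, _, h.isSegmentOperator_sinOperator hL, h.isFunctionOf_sinOperator hL, rfl,
      fun q => h.isGeneralizedEigenvector_add hL q,
      fun q hq => h.isGeneralizedEigenvector_sub hL hq⟩
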